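/- Let $F$ be a number field in which $3$ splits completely, let $t\in F$, put $$g(x;t)=x^3+t\,x^2-(t+3)x+1,\qquad \delta=t^2+3t+9,$$ let $\alpha$ be a root of $g(x;t)$ in an extension field of $F$ with $\alpha\notin F$, and let $K=F(\alpha)$, a cyclic cubic extension of $F$. For a finite prime $\mathfrak p$ of $F$ let $F_{\mathfrak p}$ be the completion of $F$ at $\mathfrak p$ and $\nu_{\mathfrak p}$ the normalized additive $\mathfrak p$-adic valuation. Let $n_{\mathfrak p}$ be the exponent of the $\mathfrak p$-conductor of $K/F$: for any prime $\mathfrak P$ of $K$ above $\mathfrak p$, it is the least integer $n\ge 0$ such that $U_{\mathfrak p}^{(n)}\subseteq N_{K_{\mathfrak P}/F_{\mathfrak p}}(K_{\mathfrak P}^{*})$, where $U_{\mathfrak p}^{(0)}=\mathcal O_{F_{\mathfrak p}}^{*}$ and $U_{\mathfrak p}^{(n)}=1+\mathfrak p^{n}\mathcal O_{F_{\mathfrak p}}$ for $n\ge 1$. Then, for every finite prime $\mathfrak p$ of $F$: 1. If $\nu_{\mathfrak p}(\delta)\le 0$, then $n_{\mathfrak p}=0$. 2. If $\nu_{\mathfrak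 p}(\delta)>0$ and $3\nmid \nu_{\mathfrak p}(\delta)$, then $n_{\mathfrak p}=1$ if $\mathfrak p\nmid 3$, and $n_{\mathfrak p}=2$ if $\mathfrak p\mid 3$. 3. If $\nu_{\mathfrak p}(\delta)>0$ and $3\mid \nu_{\mathfrak p}(\delta)$, then $n_{\mathfrak p}=0$ if $\mathfrak p\nmid 3$; and if $\mathfrak p\mid 3$, then $n_{\mathfrak p}=0$ when $\delta\notin F_{\mathfrak p}^{*3}$ and $n_{\mathfrak p}=2$ when $\delta\in F_{\mathfrak p}^{*3}$. -/

import Mathlib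

open IsDedekindDomain NumberField
open scoped WithZero

noncomputable section

namespace CubicConductor

/-- The polynomial `g(x; t) = x³ + t x² - (t + 3) x + 1`. -/
def genericPoly {F : Type*} [Field F] (t : F) : Polynomial F :=
  Polynomial.X ^ 3 + Polynomial.C t * Polynomial.X ^ 2
    - Polynomial.C (t + 3) * Polynomial.X + 1

/-- `δ(g) = t² + 3 t + 9`. -/
def delta {F : Type*} [Field F] (t : F) : F := t ^ 2 + 3 * t + 9

/-- The rational prime `3` splits completely in the number field `F`: every prime of `𝓞 F` above
`3` has ramification index `1` and residue degree `1`. -/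
def ThreeSplitsCompletely (F : Type*) [Field F] [NumberField F] : Prop :=
  ∀ P : Ideal (𝓞 F), P.IsPrime → P.LiesOver (Ideal.span {(3 : ℤ)}) →
    Ideal.ramificationIdx' (Ideal.span {(3 : ℤ)}) P = 1 ∧
      Ideal.inertiaDeg' (Ideal.span {(3 : ℤ)}) P = 1

variable {F : Type*} [Field F] [NumberField F]

/-- The normalized additive `v`-adic valuation `ν_v : F → ℤ` (with the value `0` at `0`). -/
def ord (v : HeightOneSpectrum (𝓞 F)) (x : F) : ℤ := -WithZero.log (v.valuation F x)

/-- The higher unit groups of the completion `F_v`: `U⁽⁰⁾ = O_vˣ` and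
`U⁽ⁿ⁾ = 1 + p_vⁿ` for `n ≥ 1`. -/
def higherUnits (v : HeightOneSpectrum (𝓞 F)) (n : ℕ) : Set (v.adicCompletion F) :=
  {u | Valued.v u = 1 ∧ Valued.v (u - 1) ≤ WithZero.exp (-(n : ℤ))}

variable {K : Type*} [Field K] [NumberField K] [Algebra F K]

/-- For a prime `w` of `K` above the prime `v` of `F`, the continuous embedding `F_v → K_w` that
extends `F → K`. -/
def completionMap (v : HeightOneSpectrum (𝓞 F)) (w : HeightOneSpectrum (𝓞 K))
    [w.asIdeal.LiesOver v.asIdeal] : v.adicCompletion F →+* w.adicCompletion K :=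
  ((HeightOneSpectrum.adicCompletion.equiv K w).symm.toRingHom.comp
    (UniformSpace.Completion.mapRingHom
      (algebraMap (WithVal (v.valuation F)) (WithVal (w.valuation K)))
      (HeightOneSpectrum.uniformContinuous_algebraMap_liesOver F K v w).continuous)).comp
    (HeightOneSpectrum.adicCompletion.equiv F v).toRingHom

/-- The norm map `N : K_w → F_v` of the extension of local fields `K_w / F_v`. -/
def localNorm (v : HeightOneSpectrum (𝓞 F)) (w : HeightOneSpectrum (𝓞 K))
    [w.asIdeal.LiesOver v.asIdeal] : w.adicCompletion K →* v.adicCompletion F :=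
  letI : Algebra (v.adicCompletion F) (w.adicCompletion K) := (completionMap v w).toAlgebra
  Algebra.norm (v.adicCompletion F)

/-- `n` is the conductor exponent of the local extension `K_w / F_v`: the least natural number `n`
such that every element of `U⁽ⁿ⁾` is the norm of an element of `K_wˣ`. -/
def IsConductorExponent (v : HeightOneSpectrum (𝓞 F)) (w : HeightOneSpectrum (𝓞 K))
    [w.asIdeal.LiesOver v.asIdeal] (n : ℕ) : Prop :=
  IsLeast {m : ℕ | ∀ u ∈ higherUnits v m, ∃ y : (w.adicCompletion K)ˣ,
    localNorm v w (y : w.adicCompletion K) = u} n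

/-- `x ∈ F_v^{*3}`: the image of `x` in the completion `F_v` is a cube of a nonzero element. -/
def IsLocalCube (v : HeightOneSpectrum (𝓞 F)) (x : F) : Prop :=
  ∃ y : (v.adicCompletion F)ˣ, (y : v.adicCompletion F) ^ 3 = algebraMap F (v.adicCompletion F) x

end CubicConductor

end

/-!
The statement is local. Write `k = F_v`, `L = K_w`. The subfield `k(α)` of `L` is finite-dimensional
over `k`, hence closed, and contains the dense subfield `K`, so `L = k(α)`
(`adjoin_completion_eq_top`). The roots of `g(x; t)` are permuted by `x ↦ 1 / (1 - x)`, so either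
`L = k`, when there is nothing to prove, or `[L : k] = 3`
(`bijective_or_finrank_eq_three`). In the second case the norm is an explicit cubic form in the
coordinates with respect to `1, θ, θ²` for any `θ ∈ L` outside `k` (`norm_eq_cubicNormForm`), every
cube of `k` is a norm, and the existence of norms is a matter of Hensel's lemma for cubic polynomials
(`cubicHensel_completion`). No class field theory is used.

At a prime not above three the units congruent to `1` are cubes, so the exponent is at most `1`. If
`k` contains no primitive cube root of unity `ω`, then all units are cubes. Otherwise
`L = k(∛a)` with `a = -δ (t - 3 ω)` (`lagrange_resolvent`), and the order of `a` is
divisible by three exactly when that of `δ` is nonpositive or divisible by three (`kummer_value`). If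
it is divisible by three, `a` may be replaced by a unit, which is a norm and generates the units
modulo cubes (`higherUnitsAreNorms_zero_of_kummer`). If it is not, the three main terms of the norm
form have distinct orders, so that unit norms are cubes modulo the maximal ideal
(`not_higherUnitsAreNorms_zero_of_kummer`).

At a prime above three, three is a uniformizer and the residue field is `𝔽₃`. The elements of
`1 + 9 𝒪` are cubes, so the exponent is at most `2`. If the order of `δ` is nonpositive, then `t` is
not in the maximal ideal: if `t` is a unit, units are norms of elements `1 - μ α`, and if `t` is not
integral, `g(x; t)` has a rational root. Otherwise `t = 3 s`. If `s ≢ 1`, then `δ` has order `2` and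
`α + 1` is a root of an Eisenstein cubic. If `s = 1 + 3 r`, then `δ = 27 (1 + 3 r + 3 r²)` is a cube
if and only if `r ≢ 1` (`delta_cube_iff`). For `r ≢ 1` the element `3 (1 + 2 r) / (α + 1)` is a root
of an Eisenstein cubic, and for `r ≡ 1` the element `(α + 1) / 3` is a root of an Artin–Schreier
polynomial modulo three, so that all units are norms. In the Eisenstein cases the norm form shows
that unit norms are `±1` modulo nine (`nine_dvd_cubicNormForm`), so `4` is not a norm and the exponent
is `2`.
-/

namespace CubicConductor

/-! ### Norms in cubic extensions -/

section CubicExtension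

variable {k L : Type*} [Field k] [Field L] [Algebra k L]

/-- The norm of `p + q θ + r θ²`, where `θ` is a root of `X³ + a X² + b X + c`, as a polynomial in
the coordinates. -/
def cubicNormForm {R : Type*} [CommRing R] (a b c p q r : R) : R :=
  p ^ 3 - a * p ^ 2 * q + (a ^ 2 - 2 * b) * p ^ 2 * r + b * p * q ^ 2
    + (3 * c - a * b) * p * q * r + (b ^ 2 - 2 * a * c) * p * r ^ 2 - c * q ^ 3
    + a * c * q ^ 2 * r - b * c * q * r ^ 2 + c ^ 2 * r ^ 3

theorem exists_powBasis (h3 : Module.finrank k L = 3) {θ : L}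
    (hθ : θ ∉ Set.range (algebraMap k L)) :
    ∃ b : Module.Basis (Fin 3) k L, ∀ i, b i = θ ^ (i : ℕ) := by
  have hfin : FiniteDimensional k L := Module.finite_of_finrank_pos (by omega)
  have hint : IsIntegral k θ := Algebra.IsIntegral.isIntegral θ
  have hdvd : (minpoly k θ).natDegree ∣ 3 := h3 ▸ minpoly.degree_dvd hint
  have hne : (minpoly k θ).natDegree ≠ 1 := by
    rw [Ne, minpoly.natDegree_eq_one_iff]
    exact hθ
  have hdeg : (minpoly k θ).natDegree = 3 :=
    ((Nat.dvd_prime Nat.prime_three).mp hdvd).resolve_left hne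
  have hli := linearIndependent_pow (K := k) θ
  rw [hdeg] at hli
  refine ⟨basisOfLinearIndependentOfCardEqFinrank hli (by simp [h3]), fun i ↦ by simp⟩

theorem exists_coords (h3 : Module.finrank k L = 3) {θ : L}
    (hθ : θ ∉ Set.range (algebraMap k L)) (y : L) :
    ∃ p q r : k, y = algebraMap k L p + algebraMap k L q * θ + algebraMap k L r * θ ^ 2 := by
  obtain ⟨b, hb⟩ := exists_powBasis h3 hθ
  refine ⟨b.repr y 0, b.repr y 1, b.repr y 2, ?_⟩
  conv_lhs => rw [← b.sum_repr y]
  simp [Fin.sum_univ_three, hb, Algebra.smul_def]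

theorem norm_eq_cubicNormForm (h3 : Module.finrank k L = 3) {θ : L}
    (hθ : θ ∉ Set.range (algebraMap k L)) {a b c : k}
    (hroot : θ ^ 3 + algebraMap k L a * θ ^ 2 + algebraMap k L b * θ + algebraMap k L c = 0)
    (p q r : k) :
    Algebra.norm k (algebraMap k L p + algebraMap k L q * θ + algebraMap k L r * θ ^ 2) =
      cubicNormForm a b c p q r := by
  obtain ⟨B, hB⟩ := exists_powBasis h3 hθ
  set x := algebraMap k L p + algebraMap k L q * θ + algebraMap k L r * θ ^ 2 with hx
  let M : Matrix (Fin 3) (Fin 3) k :=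
    !![p, -r * c, -q * c + r * a * c;
       q, p - r * b, -q * b + r * (a * b - c);
       r, q - r * a, p - q * a + r * (a ^ 2 - b)]
  have hM : Algebra.leftMulMatrix B x = M := by
    have key : ∀ j, x * B j = ∑ i, M i j • B i := by
      intro j
      fin_cases j <;>
        simp [Fin.sum_univ_three, hB, Algebra.smul_def, M, hx]
      · linear_combination (algebraMap k L r) * hroot
      · linear_combination (algebraMap k L q + algebraMap k L r * θ
          - algebraMap k L r * algebraMap k L a) * hroot
    ext i j
    rw [Algebra.leftMulMatrix_eq_repr_mul, key, B.repr_sum_self]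
  rw [Algebra.norm_eq_matrix_det B, hM, Matrix.det_fin_three]
  simp [M, cubicNormForm]
  ring

end CubicExtension

/-! ### The roots of `g(x; t)` -/

section SimplestCubic

variable {k L : Type*} [Field k] [Field L] [Algebra k L]

theorem root_ne {k : Type*} [Field k] {t x : k} (hx : x ^ 3 + t * x ^ 2 - (t + 3) * x + 1 = 0) :
    x ≠ 0 ∧ 1 - x ≠ 0 := by
  constructor
  · rintro rfl
    simp at hx
  · intro h
    obtain rfl : x = 1 := by linear_combination -h
    exact one_ne_zero (α := k) (by linear_combination -hx)

/-- The three roots of `g(x; t)` are permuted cyclically by `x ↦ 1 / (1 - x)`, so one rational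
root gives three. -/
theorem mem_range_of_root {t x : k} (hx : x ^ 3 + t * x ^ 2 - (t + 3) * x + 1 = 0) {α : L}
    (hα : α ^ 3 + algebraMap k L t * α ^ 2 - (algebraMap k L t + 3) * α + 1 = 0) :
    α ∈ Set.range (algebraMap k L) := by
  obtain ⟨hx0, hx1⟩ := root_ne hx
  set φ := algebraMap k L
  have hX : φ x ^ 3 + φ t * φ x ^ 2 - (φ t + 3) * φ x + 1 = 0 := by
    simpa [φ, map_ofNat] using congrArg φ hx
  have hX0 : φ x ≠ 0 := by simpa using hx0
  have hX1 : 1 - φ x ≠ 0 := by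
    rw [← map_one φ, ← map_sub]
    exact (map_ne_zero φ).mpr hx1
  have hfac : (α - φ x) * (((1 - φ x) * α - 1) * (φ x * α - (φ x - 1))) = 0 := by
    linear_combination (φ x - φ x ^ 2) * hα - (α - α ^ 2) * hX
  rcases mul_eq_zero.mp hfac with h | h
  · exact ⟨x, by linear_combination -h⟩
  rcases mul_eq_zero.mp h with h | h
  · refine ⟨1 / (1 - x), ?_⟩
    simp only [map_div₀, map_sub, map_one]
    rw [div_eq_iff hX1]
    linear_combination -h
  · refine ⟨(x - 1) / x, ?_⟩
    simp only [map_div₀, map_sub, map_one]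
    rw [div_eq_iff hX0]
    linear_combination -h

open Polynomial in
/-- A field generated by a root of `g(x; t)` is the base field or a cubic extension of it. -/
theorem bijective_or_finrank_eq_three {t : k} {α : L}
    (hα : α ^ 3 + algebraMap k L t * α ^ 2 - (algebraMap k L t + 3) * α + 1 = 0)
    (htop : IntermediateField.adjoin k {α} = ⊤) :
    Function.Bijective (algebraMap k L) ∨
      (Module.finrank k L = 3 ∧ α ∉ Set.range (algebraMap k L)) := by
  by_cases hmem : α ∈ Set.range (algebraMap k L)
  · left
    refine ⟨(algebraMap k L).injective, fun y ↦ ?_⟩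
    have : IntermediateField.adjoin k {α} = ⊥ := by
      rw [IntermediateField.adjoin_simple_eq_bot_iff]
      exact hmem
    have hy : y ∈ (⊥ : IntermediateField k L) := by rw [← this, htop]; trivial
    exact IntermediateField.mem_bot.mp hy
  right
  refine ⟨?_, hmem⟩
  let f : k[X] := X ^ 3 + C t * X ^ 2 - C (t + 3) * X + 1
  have hdeg : f.natDegree = 3 := by simp only [f]; compute_degree!
  have hmonic : f.Monic := by
    have h1 : f.coeff 3 = 1 := by simp [f, coeff_one]
    rw [Monic, leadingCoeff, hdeg, h1]
  have heval : aeval α f = 0 := by simpa [f, map_ofNat] using hα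
  have hirr : Irreducible f := by
    rw [hmonic.irreducible_iff_roots_eq_zero_of_degree_le_three (by omega) (by omega)]
    refine Multiset.eq_zero_of_forall_notMem fun x hx ↦ hmem ?_
    have := (mem_roots hmonic.ne_zero).mp hx
    exact mem_range_of_root (t := t) (x := x) (by simpa [f] using this) hα
  have hmin : minpoly k α = f := (minpoly.eq_of_irreducible_of_monic hirr heval hmonic).symm
  have hint : IsIntegral k α := ⟨f, hmonic, by simpa [aeval_def] using heval⟩
  have := IntermediateField.adjoin.finrank hint
  rw [htop, IntermediateField.finrank_top', hmin, hdeg] at this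
  exact this

/-- With a primitive cube root of unity `ω` in the base, the cube of a Lagrange resolvent `β` of the
roots of `g(x; t)` is rational, and its product with the conjugate resolvent `β'` is `δ`. The last
equation recovers `α` from the resolvents. -/
theorem lagrange_resolvent {L : Type*} [Field L] {t α ω : L}
    (hα : α ^ 3 + t * α ^ 2 - (t + 3) * α + 1 = 0) (hω : ω ^ 2 + ω + 1 = 0) :
    ∃ β β' : L, β ^ 3 = -(t ^ 2 + 3 * t + 9) * (t - 3 * ω) ∧
      β * β' = t ^ 2 + 3 * t + 9 ∧ β + β' = 3 * α + t := by
  obtain ⟨h0, h1⟩ := root_ne hα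
  -- The other two roots are `u = 1 / (1 - α)` and `w = 1 - 1 / α`.
  obtain ⟨u, hu⟩ : ∃ u, α * u = u - 1 := ⟨1 / (1 - α), by field_simp; ring⟩
  obtain ⟨w, hw⟩ : ∃ w, α * w = α - 1 := ⟨(α - 1) / α, by field_simp⟩
  have huw : u * w = w - 1 := by
    apply mul_left_cancel₀ h1
    linear_combination hw - w * hu
  have ht : t = -(α + u + w) := by
    apply mul_left_cancel₀ (mul_ne_zero h0 h1)
    linear_combination -hα - α * hu + (1 - α) * hw
  refine ⟨α + (-1 - ω) * u + ω * w, α + ω * u + (-1 - ω) * w, ?_, ?_, ?_⟩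
  · subst ht
    clear hα
    grind
  · subst ht
    clear hα
    grind
  · rw [ht]
    ring

end SimplestCubic

/-! ### Hensel's lemma and norms of higher units -/

section Hensel

variable {k : Type*} [Field k] {Γ : Type*} [LinearOrderedCommGroupWithZero Γ]

/-- Hensel's lemma for a simple root of a polynomial of degree at most three, centred at `0`; the
leading coefficient need not be a unit. -/
def CubicHensel (V : Valuation k Γ) : Prop :=
  ∀ c₀ c₁ c₂ c₃ : k, V c₀ < 1 → V c₁ = 1 → V c₂ ≤ 1 → V c₃ ≤ 1 →
    ∃ h : k, V h < 1 ∧ c₀ + c₁ * h + c₂ * h ^ 2 + c₃ * h ^ 3 = 0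

/-- Every element of the `m`-th higher unit group of `k` is a norm from `L`. The group is given by
two inequalities, so that `m = 0` gives all units. -/
def HigherUnitsAreNorms {k : Type*} [Field k] (V : Valuation k ℤᵐ⁰) (L : Type*) [Field L]
    [Algebra k L] (m : ℕ) : Prop :=
  ∀ u : k, V u = 1 → V (u - 1) ≤ WithZero.exp (-(m : ℤ)) → ∃ y : L, Algebra.norm k y = u

variable {V : Valuation k Γ}

theorem map_eq_one_of_map_sub_lt_one {u x : k} (hu : V u = 1) (h : V (u - x) < 1) : V x = 1 := by
  have := V.map_sub_eq_of_lt_right (x := u - x) (y := u) (by rwa [hu])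
  rw [sub_sub_cancel_left, V.map_neg, hu] at this
  exact this

theorem map_eq_one_of_pow {x : k} {n : ℕ} (hn : n ≠ 0) (h : V x ^ n = 1) : V x = 1 :=
  (pow_eq_one_iff_of_nonneg zero_le hn).mp h

theorem map_natCast_le_one (n : ℕ) : V n ≤ 1 := by
  induction n with
  | zero => simp
  | succ n ih => push_cast; exact V.map_add_le ih (by simp)

theorem exists_cube_eq_of_map_sub_lt_one (H : CubicHensel V) (h3 : V 3 = 1) {u y : k}
    (hy : V y = 1) (huy : V (u - y ^ 3) < 1) : ∃ x : k, x ^ 3 = u := by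
  obtain ⟨h, -, hh⟩ := H (y ^ 3 - u) (3 * y ^ 2) (3 * y) 1 (by rwa [V.map_sub_swap])
    (by simp [h3, hy]) (by simp [h3, hy]) (by simp)
  exact ⟨y + h, by linear_combination hh⟩

end Hensel

/-! ### Units modulo cubes -/

section Residue

variable {k : Type*} [Field k] {Γ : Type*} [LinearOrderedCommGroupWithZero Γ]
  (V : Valuation k Γ)

theorem residue_eq_iff (x y : V.valuationSubring) :
    IsLocalRing.residue V.valuationSubring x = IsLocalRing.residue V.valuationSubring y ↔
      V ((x : k) - y) < 1 := by
  rw [← sub_eq_zero, ← map_sub, IsLocalRing.residue_eq_zero_iff, Valuation.mem_maximalIdeal_iff]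
  rfl

theorem residue_eq_zero_iff (x : V.valuationSubring) :
    IsLocalRing.residue V.valuationSubring x = 0 ↔ V (x : k) < 1 := by
  rw [IsLocalRing.residue_eq_zero_iff, Valuation.mem_maximalIdeal_iff]

variable {V}
variable [Finite (IsLocalRing.ResidueField V.valuationSubring)]

/-- Either the residue field has no primitive cube root of unity, and then every unit is a cube, or
a primitive cube root of unity lifts. -/
theorem units_cubes_or_exists_omega (H : CubicHensel V) (h3 : V 3 = 1) :
    (∀ u : k, V u = 1 → ∃ x : k, x ^ 3 = u) ∨ ∃ ω : k, ω ^ 2 + ω + 1 = 0 := by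
  set κ := IsLocalRing.ResidueField V.valuationSubring
  by_cases hinj : Function.Injective fun x : κ ↦ x ^ 3
  · left
    intro u hu
    obtain ⟨z, hz⟩ := (Finite.injective_iff_surjective.mp hinj)
      (IsLocalRing.residue V.valuationSubring ⟨u, hu.le⟩)
    obtain ⟨y, rfl⟩ := IsLocalRing.residue_surjective z
    have huy : V (u - (y : k) ^ 3) < 1 :=
      (residue_eq_iff V ⟨u, hu.le⟩ (y ^ 3)).mp (by rw [map_pow]; exact hz.symm)
    have hy : V (y : k) = 1 := by
      have := map_eq_one_of_map_sub_lt_one hu huy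
      rw [map_pow] at this
      exact map_eq_one_of_pow three_ne_zero this
    exact exists_cube_eq_of_map_sub_lt_one H h3 hy huy
  · right
    simp only [Function.Injective, not_forall] at hinj
    obtain ⟨x, y, hxy, hne⟩ := hinj
    have hy : y ≠ 0 := by
      rintro rfl
      exact hne (by simpa using hxy)
    have hz : (x / y) ^ 2 + x / y + 1 = 0 := by
      have h1 : x / y - 1 ≠ 0 := by
        rw [sub_ne_zero, Ne, div_eq_one_iff_eq hy]
        exact hne
      apply mul_left_cancel₀ h1
      have : (x / y) ^ 3 = 1 := by
        rw [div_pow, div_eq_one_iff_eq (pow_ne_zero 3 hy)]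
        exact hxy
      linear_combination this
    obtain ⟨s, hs⟩ := IsLocalRing.residue_surjective (x / y)
    have hs0 : V ((s : k) ^ 2 + s + 1) < 1 :=
      (residue_eq_zero_iff V (s ^ 2 + s + 1)).mp (by simpa [hs] using hz)
    have hs1 : V (2 * (s : k) + 1) = 1 := by
      apply map_eq_one_of_pow two_ne_zero
      rw [← map_pow]
      refine map_eq_one_of_map_sub_lt_one (u := -3) (by simp [h3]) ?_
      have h4 : V (4 : k) ≤ 1 := by simpa using map_natCast_le_one (V := V) 4
      rw [show (-3 : k) - (2 * s + 1) ^ 2 = -(4 * (s ^ 2 + s + 1)) by ring, V.map_neg, map_mul]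
      exact mul_lt_one_of_nonneg_of_lt_one_right h4 zero_le hs0
    obtain ⟨h, -, hh⟩ := H _ (2 * (s : k) + 1) 1 0 hs0 hs1 (by simp) (by simp)
    exact ⟨s + h, by linear_combination hh⟩

/-- Modulo cubes the units are generated by any unit that is not a cube, since the unit group of
the residue field is cyclic. -/
theorem exists_eq_pow_mul_cube (H : CubicHensel V) (h3 : V 3 = 1) {a : k} (ha : V a = 1)
    (hac : ∀ x : k, x ^ 3 ≠ a) {u : k} (hu : V u = 1) : ∃ (i : ℕ) (x : k), u = a ^ i * x ^ 3 := by
  set κ := IsLocalRing.ResidueField V.valuationSubring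
  have lift : ∀ x : k, V x = 1 → ∃ z : κˣ, ∃ hx : V x ≤ 1,
      (z : κ) = IsLocalRing.residue V.valuationSubring ⟨x, hx⟩ := by
    intro x hx
    refine ⟨Units.mk0 (IsLocalRing.residue V.valuationSubring ⟨x, hx.le⟩) ?_, hx.le, rfl⟩
    rw [← map_zero (IsLocalRing.residue V.valuationSubring), Ne, residue_eq_iff]
    simp [hx]
  have cube : ∀ x : k, V x = 1 → ∀ (z : κˣ) (hx : V x ≤ 1),
      (z : κ) ^ 3 = IsLocalRing.residue V.valuationSubring ⟨x, hx⟩ → ∃ y : k, y ^ 3 = x := by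
    intro x hx z hx' hz
    obtain ⟨y, hy⟩ := IsLocalRing.residue_surjective (z : κ)
    have huy : V (x - (y : k) ^ 3) < 1 :=
      (residue_eq_iff V ⟨x, hx'⟩ (y ^ 3)).mp (by rw [map_pow, hy]; exact hz.symm)
    have hy : V (y : k) = 1 := by
      have := map_eq_one_of_map_sub_lt_one hx huy
      rw [map_pow] at this
      exact map_eq_one_of_pow three_ne_zero this
    exact exists_cube_eq_of_map_sub_lt_one H h3 hy huy
  obtain ⟨A, hA', hA⟩ := lift a ha
  obtain ⟨U, hU', hU⟩ := lift u hu
  obtain ⟨g, hg⟩ := IsCyclic.exists_generator (α := κˣ)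
  obtain ⟨m, rfl⟩ := Subgroup.mem_zpowers_iff.mp (hg A)
  obtain ⟨n, rfl⟩ := Subgroup.mem_zpowers_iff.mp (hg U)
  have hm : ¬ (3 : ℤ) ∣ m := by
    rintro ⟨j, rfl⟩
    obtain ⟨y, hy⟩ := cube a ha (g ^ j) hA' (by
      rw [← hA, ← Units.val_pow_eq_pow_val, ← zpow_natCast, ← zpow_mul, mul_comm j]; rfl)
    exact hac y hy
  obtain ⟨i, j, hij⟩ : ∃ (i : ℕ) (j : ℤ), n = i * m + j * 3 := by
    have h1 : m % 3 = 1 ∨ m % 3 = 2 := by omega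
    have h2 : n % 3 = 0 ∨ n % 3 = 1 ∨ n % 3 = 2 := by omega
    rcases h2 with h2 | h2 | h2
    · exact ⟨0, n / 3, by push_cast; omega⟩
    · rcases h1 with h1 | h1
      · exact ⟨1, (n - m) / 3, by push_cast; omega⟩
      · exact ⟨2, (n - 2 * m) / 3, by push_cast; omega⟩
    · rcases h1 with h1 | h1
      · exact ⟨2, (n - 2 * m) / 3, by push_cast; omega⟩
      · exact ⟨1, (n - m) / 3, by push_cast; omega⟩
  have ha0 : a ≠ 0 := by rintro rfl; simp at ha
  have hq : V (u / a ^ i) = 1 := by simp [ha, hu]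
  obtain ⟨y, hy⟩ := cube (u / a ^ i) hq (g ^ j) hq.le (by
    have hai : V (a ^ i) ≤ 1 := by simp [ha]
    have h1 : IsLocalRing.residue V.valuationSubring ⟨u / a ^ i, hq.le⟩ * ((g ^ m : κˣ) : κ) ^ i =
        ((g ^ n : κˣ) : κ) := by
      rw [hU, hA, ← map_pow, ← map_mul]
      congr 1
      exact Subtype.ext (div_mul_cancel₀ u (pow_ne_zero i ha0))
    have h2 : ((g ^ m : κˣ) : κ) ^ i ≠ 0 := pow_ne_zero _ (Units.ne_zero _)
    apply mul_right_cancel₀ h2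
    rw [h1]
    norm_cast
    rw [← zpow_natCast (g ^ j), ← zpow_natCast (g ^ m), ← zpow_mul, ← zpow_mul, ← zpow_add, hij]
    congr 1
    push_cast
    ring)
  exact ⟨i, y, by rw [hy]; field_simp⟩

/-- If the base contains a primitive cube root of unity and `3` is a unit, then some unit is not
congruent to a cube. -/
theorem exists_unit_not_cube (h3 : V 3 = 1) {ω : k} (hω : ω ^ 2 + ω + 1 = 0) :
    ∃ u : k, V u = 1 ∧ ∀ x : k, V x = 1 → ¬ V (u - x ^ 3) < 1 := by
  set κ := IsLocalRing.ResidueField V.valuationSubring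
  have hω1 : V ω = 1 := by
    apply map_eq_one_of_pow three_ne_zero
    rw [← map_pow, show ω ^ 3 = 1 by linear_combination (ω - 1) * hω, map_one]
  have hninj : ¬ Function.Injective fun x : κ ↦ x ^ 3 := by
    intro hinj
    have : IsLocalRing.residue V.valuationSubring ⟨ω, hω1.le⟩ = 1 := by
      apply hinj
      simp only [one_pow]
      rw [← map_pow, ← map_one (IsLocalRing.residue V.valuationSubring)]
      congr 1
      refine Subtype.ext (?_ : ω ^ 3 = 1)
      linear_combination (ω - 1) * hω
    rw [← map_one (IsLocalRing.residue V.valuationSubring), residue_eq_iff] at this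
    have h4 : V (3 : k) < 1 := by
      rw [show (3 : k) = -((ω - 1) * (ω + 2)) by linear_combination hω, V.map_neg, map_mul]
      refine mul_lt_one_of_nonneg_of_lt_one_left zero_le this (V.map_add_le hω1.le ?_)
      simpa using map_natCast_le_one (V := V) 2
    exact h4.ne h3
  rw [Finite.injective_iff_surjective] at hninj
  simp only [Function.Surjective, not_forall, not_exists] at hninj
  obtain ⟨z, hz⟩ := hninj
  obtain ⟨s, rfl⟩ := IsLocalRing.residue_surjective z
  refine ⟨s, le_antisymm s.2 (not_lt.mp fun hs ↦ hz 0 ?_), fun x hx h ↦ hz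
    (IsLocalRing.residue V.valuationSubring ⟨x, hx.le⟩) ?_⟩
  · rw [(residue_eq_zero_iff V s).mpr hs]
    simp
  · rw [← map_pow]
    exact ((residue_eq_iff V s (⟨x, hx.le⟩ ^ 3)).mpr h).symm

end Residue

/-! ### Primes not above three -/

section Tame

variable {k L : Type*} [Field k] [Field L] [Algebra k L] {V : Valuation k ℤᵐ⁰}

theorem HigherUnitsAreNorms.zero_of_bijective (h : Function.Bijective (algebraMap k L)) :
    HigherUnitsAreNorms V L 0 := by
  intro u _ _
  refine ⟨algebraMap k L u, ?_⟩
  have : Module.finrank k L = 1 := by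
    have := (LinearEquiv.ofBijective (Algebra.linearMap k L) h).finrank_eq
    simpa using this.symm
  rw [Algebra.norm_algebraMap, this, pow_one]

theorem exists_norm_eq_of_cube (hL : Module.finrank k L = 3) {u x : k} (h : x ^ 3 = u) :
    ∃ y : L, Algebra.norm k y = u :=
  ⟨algebraMap k L x, by rw [Algebra.norm_algebraMap, hL, h]⟩

theorem higherUnitsAreNorms_one (H : CubicHensel V) (h3 : V 3 = 1)
    (hL : Module.finrank k L = 3) : HigherUnitsAreNorms V L 1 := by
  intro u _ hu1
  obtain ⟨x, hx⟩ := exists_cube_eq_of_map_sub_lt_one H h3 (y := 1) (u := u) (by simp)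
    (by
      rw [one_pow, ← WithZero.exp_zero]
      exact hu1.trans_lt (WithZero.exp_lt_exp.mpr (by norm_num)))
  exact exists_norm_eq_of_cube hL hx

theorem norm_of_cube_root (hL : Module.finrank k L = 3) {β : L}
    (hβ : β ∉ Set.range (algebraMap k L)) {a : k} (ha : β ^ 3 = algebraMap k L a) (p q r : k) :
    Algebra.norm k (algebraMap k L p + algebraMap k L q * β + algebraMap k L r * β ^ 2) =
      p ^ 3 + a * q ^ 3 + a ^ 2 * r ^ 3 - 3 * a * p * q * r := by
  rw [norm_eq_cubicNormForm hL hβ (a := 0) (b := 0) (c := -a)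
    (by simp only [map_zero, map_neg, ha]; ring), cubicNormForm]
  ring

/-- A Kummer extension `k(∛a)` with the valuation of `a` divisible by three: `a` may be taken to be
a unit, which then generates the units modulo cubes and is itself the norm of `∛a`. -/
theorem higherUnitsAreNorms_zero_of_kummer
    [Finite (IsLocalRing.ResidueField V.valuationSubring)] (H : CubicHensel V) (h3 : V 3 = 1)
    {ω : k} (hω : ω ^ 2 + ω + 1 = 0)
    (hL : Module.finrank k L = 3) {β : L} (hβ : β ∉ Set.range (algebraMap k L)) {a x : k}
    (ha : β ^ 3 = algebraMap k L a) (hx : x ≠ 0) (hax : V a = V x ^ 3) :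
    HigherUnitsAreNorms V L 0 := by
  intro u hu _
  have hVx : V x ≠ 0 := (V.ne_zero_iff).mpr hx
  have ha1 : V (a / x ^ 3) = 1 := by
    rw [map_div₀, map_pow, hax, div_self (pow_ne_zero 3 hVx)]
  have hnc : ∀ y : k, y ^ 3 ≠ a / x ^ 3 := by
    intro y hy
    have hyx : β ^ 3 = (algebraMap k L (y * x)) ^ 3 := by
      rw [ha, ← map_pow, mul_pow, hy, div_mul_cancel₀ _ (pow_ne_zero 3 hx)]
    have hω' : (algebraMap k L ω) ^ 2 + algebraMap k L ω + 1 = 0 := by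
      simpa using congrArg (algebraMap k L) hω
    set c := algebraMap k L (y * x) with hc
    have hfac : (β - c) * ((β - algebraMap k L ω * c) *
        (β - (-1 - algebraMap k L ω) * c)) = 0 := by
      linear_combination hyx - (β * c ^ 2 - c ^ 3) * hω'
    rcases mul_eq_zero.mp hfac with h | h
    · exact hβ ⟨y * x, (sub_eq_zero.mp h).symm⟩
    rcases mul_eq_zero.mp h with h | h
    · exact hβ ⟨ω * (y * x), by rw [map_mul]; exact (sub_eq_zero.mp h).symm⟩
    · exact hβ ⟨(-1 - ω) * (y * x), by simpa [hc] using (sub_eq_zero.mp h).symm⟩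
  obtain ⟨i, z, rfl⟩ := exists_eq_pow_mul_cube H h3 ha1 hnc hu
  refine ⟨(algebraMap k L x⁻¹ * β) ^ i * algebraMap k L z, ?_⟩
  have hN : Algebra.norm k β = a := by
    simpa using norm_of_cube_root hL hβ ha 0 1 0
  rw [map_mul, map_pow, map_mul, hN, Algebra.norm_algebraMap, Algebra.norm_algebraMap, hL]
  field_simp

/-- In `x + y + z - s` with `s³ = 27 x y z`, a strictly dominant term among `x`, `y`, `z` also
dominates `s`. -/
theorem map_sub_lt_of_dominant {x y z s : k} (h3 : V 3 ≤ 1) (hs : s ^ 3 = 27 * (x * y * z))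
    (hy : V y < V x) (hz : V z < V x) : V (x + y + z - s - x) < V x := by
  have hx : 0 < V x := zero_le.trans_lt hy
  have h27 : V (27 : k) ≤ 1 := by
    rw [show (27 : k) = 3 ^ 3 by norm_num, map_pow]
    exact pow_le_one₀ zero_le h3
  have hyz : V y * V z < V x * V x :=
    mul_lt_mul_of_lt_of_le_of_nonneg_of_pos hy hz.le zero_le hx
  have hsx : V s < V x := by
    refine lt_of_pow_lt_pow_left₀ 3 zero_le ?_
    calc V s ^ 3 = V 27 * (V x * (V y * V z)) := by rw [← map_pow, hs]; simp [mul_assoc]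
      _ ≤ V x * (V y * V z) := mul_le_of_le_one_left zero_le h27
      _ < V x * (V x * V x) := mul_lt_mul_of_pos_left hyz hx
      _ = V x ^ 3 := by rw [pow_succ, pow_two, mul_assoc]
  rw [show x + y + z - s - x = y + z - s by ring]
  exact V.map_sub_lt (V.map_add_lt hy hz) hsx

theorem map_eq_of_dominant {x y z s : k} (h3 : V 3 ≤ 1) (hs : s ^ 3 = 27 * (x * y * z))
    (hy : V y < V x) (hz : V z < V x) : V (x + y + z - s) = V x := by
  have := V.map_add_eq_of_lt_left (map_sub_lt_of_dominant h3 hs hy hz)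
  rwa [add_sub_cancel] at this

/-- The terms `p³`, `a q³`, `a² r³` have distinct valuations when that of `a` is not divisible by
three, so a norm that is a unit is congruent to a cube. -/
theorem kummer_norm_congr_cube {a : k} (ha : ∀ x : k, V a ≠ V x ^ 3) {p q r : k}
    (h3 : V 3 ≤ 1)
    (hN : V (p ^ 3 + a * q ^ 3 + a ^ 2 * r ^ 3 - 3 * a * p * q * r) = 1) :
    V p = 1 ∧ V (p ^ 3 + a * q ^ 3 + a ^ 2 * r ^ 3 - 3 * a * p * q * r - p ^ 3) < 1 := by
  have ha0 : a ≠ 0 := by rintro rfl; exact ha 0 (by simp)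
  have key : ∀ x y : k, y ≠ 0 → V (a * y ^ 3) ≠ V (x ^ 3) := by
    intro x y hy h
    refine ha (x / y) ?_
    rw [← map_pow, div_pow, map_div₀, ← h, ← map_div₀, mul_div_cancel_right₀ _ (pow_ne_zero 3 hy)]
  have hPQ : V (p ^ 3) = V (a * q ^ 3) → q = 0 := fun h ↦ by
    by_contra hq
    exact key p q hq h.symm
  have hQR : V (a * q ^ 3) = V (a ^ 2 * r ^ 3) → r = 0 := fun h ↦ by
    by_contra hr
    refine key q r hr (mul_left_cancel₀ ((V.ne_zero_iff).mpr ha0) ?_)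
    rw [← map_mul, ← map_mul, h]
    ring_nf
  have hPR : V (p ^ 3) = V (a ^ 2 * r ^ 3) → p = 0 := fun h ↦ by
    by_contra hp
    refine key (a * r) p hp ?_
    rw [map_mul, h, ← map_mul]
    ring_nf
  have hs : (3 * a * p * q * r) ^ 3 = 27 * (p ^ 3 * (a * q ^ 3) * (a ^ 2 * r ^ 3)) := by ring
  have hs2 : (3 * a * p * q * r) ^ 3 = 27 * (a * q ^ 3 * p ^ 3 * (a ^ 2 * r ^ 3)) := by ring
  have hs3 : (3 * a * p * q * r) ^ 3 = 27 * (a ^ 2 * r ^ 3 * p ^ 3 * (a * q ^ 3)) := by ring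
  have caseP : V (a * q ^ 3) < V (p ^ 3) → V (a ^ 2 * r ^ 3) < V (p ^ 3) →
      V p = 1 ∧ V (p ^ 3 + a * q ^ 3 + a ^ 2 * r ^ 3 - 3 * a * p * q * r - p ^ 3) < 1 := by
    intro h1 h2
    have hp : V (p ^ 3) = 1 := by rw [← map_eq_of_dominant h3 hs h1 h2, hN]
    refine ⟨map_eq_one_of_pow three_ne_zero (by rwa [← map_pow]), ?_⟩
    rw [← hp]
    exact map_sub_lt_of_dominant h3 hs h1 h2
  have caseQ : V (p ^ 3) < V (a * q ^ 3) → ¬ V (a ^ 2 * r ^ 3) < V (a * q ^ 3) := by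
    intro h1 h2
    have := map_eq_of_dominant h3 hs2 h1 h2
    rw [add_comm (a * q ^ 3), hN] at this
    refine key 1 q ?_ (by rw [← this]; simp)
    rintro rfl
    simp at this
  have caseR : V (p ^ 3) < V (a ^ 2 * r ^ 3) → ¬ V (a * q ^ 3) < V (a ^ 2 * r ^ 3) := by
    intro h1 h2
    have := map_eq_of_dominant h3 hs3 h1 h2
    rw [show a ^ 2 * r ^ 3 + p ^ 3 + a * q ^ 3 = p ^ 3 + a * q ^ 3 + a ^ 2 * r ^ 3 by ring,
      hN] at this
    refine key (a * r) 1 one_ne_zero ?_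
    rw [show (a * r) ^ 3 = a * (a ^ 2 * r ^ 3) by ring, map_mul V a (a ^ 2 * r ^ 3), ← this]
    simp
  rcases lt_trichotomy (V (a * q ^ 3)) (V (p ^ 3)) with h1 | h1 | h1
  · rcases lt_trichotomy (V (a ^ 2 * r ^ 3)) (V (p ^ 3)) with h2 | h2 | h2
    · exact caseP h1 h2
    · obtain rfl := hPR h2.symm
      simp at h1
    · exact absurd (h1.trans h2) (caseR h2)
  · obtain rfl := hPQ h1.symm
    obtain rfl : p = 0 := by simpa using h1.symm
    rcases eq_or_ne r 0 with rfl | hr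
    · simp at hN
    · have hR : 0 < V (a ^ 2 * r ^ 3) := (V.pos_iff).mpr (by positivity)
      exact absurd (by simpa using hR) (caseR (by simpa using hR))
  · rcases lt_trichotomy (V (a ^ 2 * r ^ 3)) (V (a * q ^ 3)) with h2 | h2 | h2
    · exact absurd h2 (caseQ h1)
    · obtain rfl := hQR h2.symm
      obtain rfl : q = 0 := by simpa [ha0] using h2
      simp at h1
    · exact absurd h2 (caseR (h1.trans h2))

/-- A Kummer extension `k(∛a)` with the valuation of `a` not divisible by three is tamely ramified:
its unit norms are cubes modulo the maximal ideal. -/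
theorem not_higherUnitsAreNorms_zero_of_kummer
    [Finite (IsLocalRing.ResidueField V.valuationSubring)] (h3 : V 3 = 1)
    {ω : k} (hω : ω ^ 2 + ω + 1 = 0)
    (hL : Module.finrank k L = 3) {β : L} (hβ : β ∉ Set.range (algebraMap k L)) {a : k}
    (ha : β ^ 3 = algebraMap k L a) (hav : ∀ x : k, V a ≠ V x ^ 3) :
    ¬ HigherUnitsAreNorms V L 0 := by
  intro hall
  obtain ⟨u, hu, hnc⟩ := exists_unit_not_cube h3 hω
  obtain ⟨y, hy⟩ := hall u hu (by
    simpa using V.map_sub_le hu.le (map_one V).le)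
  obtain ⟨p, q, r, rfl⟩ := exists_coords hL hβ y
  rw [norm_of_cube_root hL hβ ha] at hy
  subst hy
  obtain ⟨hp, hlt⟩ := kummer_norm_congr_cube hav h3.le hu
  exact hnc p hp hlt

/-- The value of `δ` determines that of `a = -δ (t - 3 ω)`, the cube of a Kummer generator,
modulo three. -/
theorem kummer_value (h3 : V 3 = 1) {t ω : k} (hω : ω ^ 2 + ω + 1 = 0) :
    (1 ≤ V (t ^ 2 + 3 * t + 9) → V (-(t ^ 2 + 3 * t + 9) * (t - 3 * ω)) = V (t - 3 * ω) ^ 3) ∧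
    (V (t ^ 2 + 3 * t + 9) < 1 →
      V (-(t ^ 2 + 3 * t + 9) * (t - 3 * ω)) = V (t ^ 2 + 3 * t + 9) ∨
      V (-(t ^ 2 + 3 * t + 9) * (t - 3 * ω)) = V (t ^ 2 + 3 * t + 9) ^ 2) := by
  obtain ⟨B, hB⟩ : ∃ B, B = t - 3 * (-1 - ω) := ⟨_, rfl⟩
  obtain ⟨A, hA⟩ : ∃ A, A = t - 3 * ω := ⟨_, rfl⟩
  have hδ : t ^ 2 + 3 * t + 9 = A * B := by rw [hA, hB]; linear_combination 9 * hω
  have hd : V (A - B) = 1 := by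
    apply map_eq_one_of_pow two_ne_zero
    rw [← map_pow, show (A - B) ^ 2 = -(3 * 3 * 3) by rw [hA, hB]; linear_combination 36 * hω]
    simp [h3]
  rw [← hA, hδ]
  simp only [neg_mul, V.map_neg, map_mul]
  have lt_of : ∀ x y : k, V (x - y) = 1 → V x < 1 → V y = 1 := by
    intro x y hxy hx
    have := V.map_sub_eq_of_lt_right (x := x) (y := x - y) (by rwa [hxy])
    rwa [sub_sub_cancel, hxy] at this
  have hd' : V (B - A) = 1 := by rwa [V.map_sub_swap]
  refine ⟨fun h ↦ ?_, fun h ↦ ?_⟩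
  · have hAB : V A = V B := by
      have hA1 : 1 ≤ V A := by
        by_contra! hlt
        rw [lt_of A B hd hlt, mul_one] at h
        exact absurd h (not_le.mpr hlt)
      have hB1 : 1 ≤ V B := by
        by_contra! hlt
        rw [lt_of B A hd' hlt, one_mul] at h
        exact absurd h (not_le.mpr hlt)
      rcases hA1.eq_or_lt with hA2 | hA2
      · refine le_antisymm (hA2 ▸ hB1) ?_
        rw [← hA2]
        simpa using V.map_sub_le hA2.symm.le hd.le
      · have := V.map_sub_eq_of_lt_right (x := A - B) (y := A) (by rwa [hd])
        rwa [sub_sub_cancel_left, V.map_neg, eq_comm] at this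
    rw [← hAB, pow_succ, pow_two]
  · rcases lt_or_ge (V A) 1 with h1 | h1
    · right
      rw [lt_of A B hd h1, mul_one, pow_two]
    · left
      have h2 : V B < 1 := by
        by_contra! h2
        exact absurd h (not_lt.mpr (one_le_mul h1 h2))
      rw [lt_of B A hd' h2]
      simp

/-- A prime not above three that divides `δ` divides the value of `x² + x + 1` at `x = t / 3`, which
is then close to a primitive cube root of unity. -/
theorem exists_omega_of_delta_lt_one (H : CubicHensel V) (h3 : V 3 = 1) {t : k}
    (hδ : V (t ^ 2 + 3 * t + 9) < 1) : ∃ ω : k, ω ^ 2 + ω + 1 = 0 := by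
  have h30 : (3 : k) ≠ 0 := by rintro h; simp [h] at h3
  have hs0 : V ((t / 3) ^ 2 + t / 3 + 1) < 1 := by
    rw [show (t / 3) ^ 2 + t / 3 + 1 = (t ^ 2 + 3 * t + 9) / 3 ^ 2 by field_simp; ring]
    simpa [h3] using hδ
  have hs1 : V (2 * (t / 3) + 1) = 1 := by
    apply map_eq_one_of_pow two_ne_zero
    rw [← map_pow]
    refine map_eq_one_of_map_sub_lt_one (u := -3) (by simp [h3]) ?_
    have h4 : V (4 : k) ≤ 1 := by simpa using map_natCast_le_one (V := V) 4
    rw [show (-3 : k) - (2 * (t / 3) + 1) ^ 2 = -(4 * ((t / 3) ^ 2 + t / 3 + 1)) by ring,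
      V.map_neg, map_mul]
    exact mul_lt_one_of_nonneg_of_lt_one_right h4 zero_le hs0
  obtain ⟨h, -, hh⟩ := H _ (2 * (t / 3) + 1) 1 0 hs0 hs1 (by simp) (by simp)
  exact ⟨t / 3 + h, by linear_combination hh⟩

/-- The Kummer generator of the cubic extension given by `g(x; t)`. -/
theorem exists_kummer_generator (h3 : (3 : k) ≠ 0) {t ω : k} (hω : ω ^ 2 + ω + 1 = 0) {α : L}
    (hα : α ^ 3 + algebraMap k L t * α ^ 2 - (algebraMap k L t + 3) * α + 1 = 0)
    (hαk : α ∉ Set.range (algebraMap k L)) (hδ : t ^ 2 + 3 * t + 9 ≠ 0) :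
    ∃ β : L, β ∉ Set.range (algebraMap k L) ∧
      β ^ 3 = algebraMap k L (-(t ^ 2 + 3 * t + 9) * (t - 3 * ω)) := by
  have hω' : (algebraMap k L ω) ^ 2 + algebraMap k L ω + 1 = 0 := by
    simpa using congrArg (algebraMap k L) hω
  obtain ⟨β, β', hβ, hββ, hsum⟩ := lagrange_resolvent hα hω'
  refine ⟨β, ?_, by simpa [map_ofNat] using hβ⟩
  rintro ⟨b, rfl⟩
  set φ := algebraMap k L
  have hδ' : φ t ^ 2 + 3 * φ t + 9 = φ (t ^ 2 + 3 * t + 9) := by simp [map_ofNat]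
  have hb : φ b ≠ 0 := by
    intro h
    rw [h, zero_mul, hδ'] at hββ
    exact hδ ((map_eq_zero φ).mp hββ.symm)
  have h3' : (3 : L) ≠ 0 := by
    rw [← map_ofNat φ 3]
    exact (map_ne_zero φ).mpr h3
  refine hαk ⟨(b + (t ^ 2 + 3 * t + 9) / b - t) / 3, ?_⟩
  simp only [map_div₀, map_sub, map_add φ b, ← hδ', map_ofNat]
  rw [div_eq_iff h3', ← hββ, mul_div_cancel_left₀ _ hb]
  linear_combination hsum

/-- The conductor exponent is `0` at a prime not above three where the order of `δ` is nonpositive or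
divisible by three. -/
theorem tame_unramified [Finite (IsLocalRing.ResidueField V.valuationSubring)]
    (H : CubicHensel V) (h3 : V 3 = 1) {t : k} {α : L}
    (hα : α ^ 3 + algebraMap k L t * α ^ 2 - (algebraMap k L t + 3) * α + 1 = 0)
    (htop : IntermediateField.adjoin k {α} = ⊤) (hδ0 : t ^ 2 + 3 * t + 9 ≠ 0)
    (hδ : 1 ≤ V (t ^ 2 + 3 * t + 9) ∨ ∃ x, V (t ^ 2 + 3 * t + 9) = V x ^ 3) :
    HigherUnitsAreNorms V L 0 := by
  rcases bijective_or_finrank_eq_three hα htop with hbij | ⟨hL, hαk⟩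
  · exact .zero_of_bijective hbij
  rcases units_cubes_or_exists_omega H h3 with hcub | ⟨ω, hω⟩
  · intro u hu _
    obtain ⟨x, hx⟩ := hcub u hu
    exact exists_norm_eq_of_cube hL hx
  have h30 : (3 : k) ≠ 0 := by rintro h; simp [h] at h3
  obtain ⟨β, hβ, hβ3⟩ := exists_kummer_generator h30 hω hα hαk hδ0
  obtain ⟨hge, hlt⟩ := kummer_value h3 (t := t) hω
  obtain ⟨x, hx⟩ : ∃ x, V (-(t ^ 2 + 3 * t + 9) * (t - 3 * ω)) = V x ^ 3 := by
    rcases le_or_gt 1 (V (t ^ 2 + 3 * t + 9)) with h | h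
    · exact ⟨_, hge h⟩
    obtain ⟨x, hx⟩ := hδ.resolve_left (not_le.mpr h)
    rcases hlt h with h | h
    · exact ⟨x, h.trans hx⟩
    · exact ⟨x ^ 2, by rw [h, hx, map_pow, ← pow_mul, ← pow_mul]⟩
  have hx0 : x ≠ 0 := by
    rintro rfl
    rw [map_zero, zero_pow three_ne_zero, map_eq_zero] at hx
    rw [hx, map_zero] at hβ3
    exact hβ ⟨0, by rw [map_zero, eq_zero_of_pow_eq_zero hβ3]⟩
  exact higherUnitsAreNorms_zero_of_kummer H h3 hω hL hβ hβ3 hx0 hx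

/-- The conductor exponent is `1` at a prime not above three where the order of `δ` is positive and
not divisible by three. -/
theorem tame_ramified [Finite (IsLocalRing.ResidueField V.valuationSubring)]
    (H : CubicHensel V) (h3 : V 3 = 1) {t : k} {α : L}
    (hα : α ^ 3 + algebraMap k L t * α ^ 2 - (algebraMap k L t + 3) * α + 1 = 0)
    (htop : IntermediateField.adjoin k {α} = ⊤)
    (hδ : V (t ^ 2 + 3 * t + 9) < 1) (hδ3 : ∀ x, V (t ^ 2 + 3 * t + 9) ≠ V x ^ 3) :
    HigherUnitsAreNorms V L 1 ∧ ¬ HigherUnitsAreNorms V L 0 := by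
  obtain ⟨ω, hω⟩ := exists_omega_of_delta_lt_one H h3 hδ
  have hδ0 : t ^ 2 + 3 * t + 9 ≠ 0 := fun h ↦ hδ3 0 (by simp [h])
  have hδ0' : V (t ^ 2 + 3 * t + 9) ≠ 0 := V.ne_zero_iff.mpr hδ0
  have hav : ∀ x, V (-(t ^ 2 + 3 * t + 9) * (t - 3 * ω)) ≠ V x ^ 3 := by
    intro x hx
    rcases (kummer_value h3 hω).2 hδ with h | h
    · exact hδ3 x (h.symm.trans hx)
    · refine hδ3 ((t ^ 2 + 3 * t + 9) / x) ?_
      rw [map_div₀, div_pow, ← hx, h, eq_div_iff (pow_ne_zero 2 hδ0'), ← pow_succ']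
  rcases bijective_or_finrank_eq_three hα htop with hbij | ⟨hL, hαk⟩
  · exfalso
    have hω' : (algebraMap k L ω) ^ 2 + algebraMap k L ω + 1 = 0 := by
      simpa using congrArg (algebraMap k L) hω
    obtain ⟨β, -, hβ, -⟩ := lagrange_resolvent hα hω'
    obtain ⟨b, rfl⟩ := hbij.2 β
    refine hav b ?_
    rw [← map_pow]
    congr 1
    apply (algebraMap k L).injective
    simpa [map_ofNat] using hβ.symm
  have h30 : (3 : k) ≠ 0 := by rintro h; simp [h] at h3
  obtain ⟨β, hβ, hβ3⟩ := exists_kummer_generator h30 hω hα hαk hδ0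
  exact ⟨higherUnitsAreNorms_one H h3 hL,
    not_higherUnitsAreNorms_zero_of_kummer h3 hω hL hβ hβ3 hav⟩

end Tame

/-! ### Norm forms of Eisenstein cubics -/

section EisensteinForm

variable {R : Type*} [CommRing R]

/-- The norm form of an Eisenstein cubic whose linear coefficient is divisible by nine is anisotropic
modulo `27`. -/
theorem three_dvd_of_dvd_cubicNormForm [IsDomain R] (h3 : Prime (3 : R)) {a b c p q r : R} (hc : ¬ (3 : R) ∣ c)
    (h : (27 : R) ∣ cubicNormForm (3 * a) (9 * b) (3 * c) p q r) :
    (3 : R) ∣ p ∧ (3 : R) ∣ q ∧ (3 : R) ∣ r := by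
  obtain ⟨n, hn⟩ := h
  rw [cubicNormForm] at hn
  have hp : (3 : R) ∣ p := by
    refine h3.dvd_of_dvd_pow (n := 3) ⟨9 * n + a * p ^ 2 * q - (3 * a ^ 2 - 6 * b) * p ^ 2 * r
      - 3 * b * p * q ^ 2 - (3 * c - 9 * a * b) * p * q * r - (27 * b ^ 2 - 6 * a * c) * p * r ^ 2
      + c * q ^ 3 - 3 * a * c * q ^ 2 * r + 9 * b * c * q * r ^ 2 - 3 * c ^ 2 * r ^ 3, ?_⟩
    linear_combination hn
  obtain ⟨p, rfl⟩ := hp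
  have hq : (3 : R) ∣ q := by
    have hq' : (3 : R) ∣ c * q ^ 3 := by
      refine ⟨3 * p ^ 3 - 3 * a * p ^ 2 * q + (9 * a ^ 2 - 18 * b) * p ^ 2 * r + 3 * b * p * q ^ 2
        + (3 * c - 9 * a * b) * p * q * r + (27 * b ^ 2 - 6 * a * c) * p * r ^ 2
        + a * c * q ^ 2 * r - 3 * b * c * q * r ^ 2 + c ^ 2 * r ^ 3 - 3 * n, ?_⟩
      apply mul_left_cancel₀ h3.ne_zero
      linear_combination -hn
    exact h3.dvd_of_dvd_pow ((h3.dvd_or_dvd hq').resolve_left hc)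
  obtain ⟨q, rfl⟩ := hq
  refine ⟨dvd_mul_right _ _, dvd_mul_right _ _, ?_⟩
  have hr' : (3 : R) ∣ c ^ 2 * r ^ 3 := by
    refine ⟨n - p ^ 3 + 3 * a * p ^ 2 * q - (3 * a ^ 2 - 6 * b) * p ^ 2 * r - 9 * b * p * q ^ 2
        - (3 * c - 9 * a * b) * p * q * r - (9 * b ^ 2 - 2 * a * c) * p * r ^ 2 + 3 * c * q ^ 3
        - 3 * a * c * q ^ 2 * r + 3 * b * c * q * r ^ 2, ?_⟩
    apply mul_left_cancel₀ (pow_ne_zero 2 h3.ne_zero)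
    linear_combination hn
  exact h3.dvd_of_dvd_pow ((h3.dvd_or_dvd hr').resolve_left
    fun h ↦ hc (h3.dvd_of_dvd_pow h))

theorem three_dvd_cube_sub (hres : ∀ x : R, 3 ∣ x ∨ 3 ∣ x - 1 ∨ 3 ∣ x + 1) (x : R) :
    (3 : R) ∣ x ^ 3 - x := by
  rcases hres x with h | h | h
  · exact (h.mul_right (x ^ 2 - 1)).trans (dvd_of_eq (by ring))
  · exact (h.mul_right (x ^ 2 + x)).trans (dvd_of_eq (by ring))
  · exact (h.mul_right (x ^ 2 - x)).trans (dvd_of_eq (by ring))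

theorem nine_dvd_cube_sub_one {x : R} (h : 3 ∣ x - 1) : (9 : R) ∣ x ^ 3 - 1 := by
  obtain ⟨y, hy⟩ := h
  obtain rfl : x = 1 + 3 * y := by linear_combination hy
  exact ⟨y + 3 * y ^ 2 + 3 * y ^ 3, by ring⟩

/-- A value of the norm form of an Eisenstein cubic prime to three is congruent to `±1` modulo
nine: with residue field `𝔽₃`, the terms of order three in the form cancel because
`x³ ≡ x` and `a + c ≡ 0`. -/
theorem nine_dvd_cubicNormForm (hres : ∀ x : R, 3 ∣ x ∨ 3 ∣ x - 1 ∨ 3 ∣ x + 1)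
    {a b c p q r : R} (hac : 3 ∣ a + c)
    (h : ¬ (3 : R) ∣ cubicNormForm (3 * a) (9 * b) (3 * c) p q r) :
    (9 : R) ∣ cubicNormForm (3 * a) (9 * b) (3 * c) p q r - 1 ∨
      (9 : R) ∣ cubicNormForm (3 * a) (9 * b) (3 * c) p q r + 1 := by
  obtain ⟨Z, hZ⟩ : ∃ Z, cubicNormForm (3 * a) (9 * b) (3 * c) p q r =
      p ^ 3 - 3 * (a * p ^ 2 * q + c * q ^ 3) + 9 * Z := by
    refine ⟨(a ^ 2 - 2 * b) * p ^ 2 * r + b * p * q ^ 2 + (c - 3 * a * b) * p * q * r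
      + (9 * b ^ 2 - 2 * a * c) * p * r ^ 2 + a * c * q ^ 2 * r - 3 * b * c * q * r ^ 2
      + c ^ 2 * r ^ 3, ?_⟩
    rw [cubicNormForm]
    ring
  have hp : ¬ (3 : R) ∣ p := by
    rintro ⟨p, rfl⟩
    exact h ⟨9 * p ^ 3 - (a * (3 * p) ^ 2 * q + c * q ^ 3) + 3 * Z, by rw [hZ]; ring⟩
  have hp2 : (3 : R) ∣ p ^ 2 - 1 := by
    rcases (hres p).resolve_left hp with h | h
    · exact (h.mul_right (p + 1)).trans (dvd_of_eq (by ring))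
    · exact (h.mul_right (p - 1)).trans (dvd_of_eq (by ring))
  obtain ⟨x, hx⟩ := hp2
  obtain ⟨y, hy⟩ := three_dvd_cube_sub hres q
  obtain ⟨z, hz⟩ := hac
  have hW : cubicNormForm (3 * a) (9 * b) (3 * c) p q r =
      p ^ 3 + 9 * (Z - a * q * x - c * y - z * q) := by
    rw [hZ]
    linear_combination -3 * a * q * hx - 3 * c * hy - 3 * q * hz
  rcases (hres p).resolve_left hp with h | h
  · left
    rw [hW, add_sub_right_comm]
    exact dvd_add (nine_dvd_cube_sub_one h) (dvd_mul_right _ _)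
  · right
    have h' : (3 : R) ∣ -p - 1 := by
      rw [← dvd_neg]
      exact h.trans (dvd_of_eq (by ring))
    rw [hW, add_right_comm]
    refine dvd_add ?_ (dvd_mul_right _ _)
    rw [← dvd_neg]
    exact (nine_dvd_cube_sub_one h').trans (dvd_of_eq (by ring))

end EisensteinForm

/-! ### Primes above three -/

section Wild

variable {k L : Type*} [Field k] [Field L] [Algebra k L] {V : Valuation k ℤᵐ⁰}

theorem HigherUnitsAreNorms.mono {m n : ℕ} (hmn : m ≤ n) (h : HigherUnitsAreNorms V L m) :
    HigherUnitsAreNorms V L n := by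
  intro u hu hun
  refine h u hu (hun.trans ?_)
  rw [WithZero.exp_le_exp]
  omega

theorem map_le_exp_neg_one {x : k} (hx : V x < 1) : V x ≤ WithZero.exp (-1) := by
  rcases eq_or_ne (V x) 0 with h | h
  · simp [h]
  · rw [← WithZero.exp_log h, ← WithZero.exp_zero, WithZero.exp_lt_exp] at hx
    rw [← WithZero.exp_log h, WithZero.exp_le_exp]
    omega

@[simp, norm_cast]
theorem coe_integer_ofNat (n : ℕ) [n.AtLeastTwo] :
    ((ofNat(n) : V.integer) : k) = ofNat(n) :=
  rfl

/-- Three is a uniformizer for `V` and every integer is congruent to `0` or `±1`: the properties of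
`ℚ₃` that hold in the completion at a prime above three when three splits completely. -/
structure IsThreeAdic (V : Valuation k ℤᵐ⁰) : Prop where
  map_three : V 3 = WithZero.exp (-1)
  residue : ∀ x : k, V x ≤ 1 → V x < 1 ∨ V (x - 1) < 1 ∨ V (x + 1) < 1

namespace IsThreeAdic

theorem three_ne_zero (hV : IsThreeAdic V) : (3 : k) ≠ 0 := by
  intro h
  have := hV.map_three
  rw [h, map_zero] at this
  exact WithZero.exp_ne_zero this.symm

theorem exists_eq_mul (hV : IsThreeAdic V) {x : k} (n : ℕ) (hx : V x ≤ WithZero.exp (-(n : ℤ))) :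
    ∃ y, V y ≤ 1 ∧ x = 3 ^ n * y := by
  have h3 := pow_ne_zero n hV.three_ne_zero
  refine ⟨x / 3 ^ n, ?_, by field_simp⟩
  rw [map_div₀, map_pow, hV.map_three, ← WithZero.exp_nsmul]
  refine div_le_one_of_le₀ (hx.trans ?_) zero_le
  simp

theorem exists_eq_three_mul (hV : IsThreeAdic V) {x : k} (hx : V x < 1) : ∃ y, V y ≤ 1 ∧ x = 3 * y := by
  simpa using hV.exists_eq_mul 1 (by simpa using map_le_exp_neg_one hx)

theorem map_three_lt_one (hV : IsThreeAdic V) : V (3 : k) < 1 := by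
  rw [hV.map_three, ← WithZero.exp_zero, WithZero.exp_lt_exp]
  norm_num

theorem three_dvd_iff (hV : IsThreeAdic V) {x : V.integer} : 3 ∣ x ↔ V (x : k) < 1 := by
  constructor
  · rintro ⟨y, rfl⟩
    push_cast
    rw [map_mul]
    exact mul_lt_one_of_nonneg_of_lt_one_left zero_le hV.map_three_lt_one y.2
  · intro h
    obtain ⟨y, hy, hxy⟩ := hV.exists_eq_three_mul h
    exact ⟨⟨y, hy⟩, Subtype.ext (by simpa using hxy)⟩

theorem prime_three (hV : IsThreeAdic V) : Prime (3 : V.integer) := by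
  refine ⟨fun h ↦ hV.three_ne_zero (by simpa using congrArg Subtype.val h), fun h ↦ ?_,
    fun x y h ↦ ?_⟩
  · have := hV.three_dvd_iff.mp (h.dvd (a := 1))
    simp at this
  · by_contra! hn
    rw [hV.three_dvd_iff] at h
    have hx : V (x : k) = 1 := le_antisymm x.2 (not_lt.mp fun h ↦ hn.1 (hV.three_dvd_iff.mpr h))
    have hy : V (y : k) = 1 := le_antisymm y.2 (not_lt.mp fun h ↦ hn.2 (hV.three_dvd_iff.mpr h))
    simp [hx, hy] at h

theorem residue_integer (hV : IsThreeAdic V) (x : V.integer) : 3 ∣ x ∨ 3 ∣ x - 1 ∨ 3 ∣ x + 1 := by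
  simp only [hV.three_dvd_iff]
  exact hV.residue x x.2

theorem exists_scaling (hV : IsThreeAdic V) (x : k) : ∃ n : ℕ, ∀ m ≥ n, V (3 ^ m * x) ≤ 1 := by
  rcases eq_or_ne x 0 with rfl | hx
  · exact ⟨0, fun m _ ↦ by simp⟩
  have h : V x ≠ 0 := V.ne_zero_iff.mpr hx
  refine ⟨(WithZero.log (V x)).toNat, fun m hm ↦ ?_⟩
  rw [map_mul, map_pow, hV.map_three, ← WithZero.exp_nsmul, ← WithZero.exp_log h,
    ← WithZero.exp_add, ← WithZero.exp_zero, WithZero.exp_le_exp]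
  simp
  omega

/-- Coordinates of an element with integral norm, in the powers of an Eisenstein generator, are
integral. -/
theorem integral_of_cubicNormForm (hV : IsThreeAdic V) {a b c : V.integer} (hc : ¬ 3 ∣ c) {p q r : k}
    (hN : V (cubicNormForm (3 * a : k) (9 * b) (3 * c) p q r) ≤ 1) :
    V p ≤ 1 ∧ V q ≤ 1 ∧ V r ≤ 1 := by
  have step : ∀ n : ℕ, V (3 ^ n * p) ≤ 1 → V (3 ^ n * q) ≤ 1 → V (3 ^ n * r) ≤ 1 →
      V p ≤ 1 ∧ V q ≤ 1 ∧ V r ≤ 1 := by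
    intro n
    induction n with
    | zero => simpa using fun h1 h2 h3 ↦ ⟨h1, h2, h3⟩
    | succ n ih =>
      intro hp hq hr
      let P : V.integer := ⟨_, hp⟩
      let Q : V.integer := ⟨_, hq⟩
      let S : V.integer := ⟨_, hr⟩
      let T : V.integer := ⟨_, hN⟩
      have hdvd : (27 : V.integer) ∣ cubicNormForm (3 * a) (9 * b) (3 * c) P Q S := by
        refine ⟨27 ^ n * T, Subtype.ext ?_⟩
        simp only [cubicNormForm, P, Q, S, T]
        push_cast
        rw [show (27 : k) ^ n = (3 ^ n) ^ 3 by rw [← pow_mul, mul_comm, pow_mul]; norm_num]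
        ring
      obtain ⟨h1, h2, h3⟩ := three_dvd_of_dvd_cubicNormForm hV.prime_three hc hdvd
      have key : ∀ x : k, ∀ hx : V (3 ^ (n + 1) * x) ≤ 1, 3 ∣ (⟨_, hx⟩ : V.integer) →
          V (3 ^ n * x) ≤ 1 := by
        rintro x hx ⟨y, hy⟩
        have h : (3 : k) ^ (n + 1) * x = 3 * y := congrArg Subtype.val hy
        have : (3 : k) ^ n * x = y := by
          apply mul_left_cancel₀ hV.three_ne_zero
          rw [← h]
          ring
        rw [this]
        exact y.2
      exact ih (key p hp h1) (key q hq h2) (key r hr h3)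
  obtain ⟨n₁, h₁⟩ := hV.exists_scaling p
  obtain ⟨n₂, h₂⟩ := hV.exists_scaling q
  obtain ⟨n₃, h₃⟩ := hV.exists_scaling r
  exact step (n₁ + n₂ + n₃) (h₁ _ (by omega)) (h₂ _ (by omega)) (h₃ _ (by omega))

theorem eisenstein_no_root (hV : IsThreeAdic V) {a b c : V.integer} (hc : ¬ 3 ∣ c) (x : k) :
    x ^ 3 + 3 * a * x ^ 2 + 9 * b * x + 3 * c ≠ 0 := by
  intro hx
  -- The norm form vanishes at `(x, -1, 0)`, hence at every multiple of it.
  have h0 : cubicNormForm (3 * a : k) (9 * b) (3 * c) (x / 3) (-1 / 3) 0 = 0 := by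
    have h3 := hV.three_ne_zero
    have : cubicNormForm (3 * a : k) (9 * b) (3 * c) (x / 3) (-1 / 3) 0 =
        (x ^ 3 + 3 * a * x ^ 2 + 9 * b * x + 3 * c) / 27 := by
      rw [cubicNormForm, show (27 : k) = 3 ^ 3 by norm_num]
      field_simp
      ring
    rw [this, hx, zero_div]
  have := (hV.integral_of_cubicNormForm hc (by rw [h0]; simp)).2.1
  rw [map_div₀, V.map_neg, map_one, hV.map_three, ← WithZero.exp_zero, ← WithZero.exp_sub,
    WithZero.exp_le_exp] at this
  norm_num at this

/-- The unit `4` is not a norm from a ramified cyclic cubic extension. -/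
theorem not_higherUnitsAreNorms_one (hV : IsThreeAdic V) {a b c : V.integer} (hc : ¬ 3 ∣ c) (hac : 3 ∣ a + c)
    (hL : Module.finrank k L = 3) {π : L} (hπ : π ∉ Set.range (algebraMap k L))
    (hroot : π ^ 3 + algebraMap k L (3 * a) * π ^ 2 + algebraMap k L (9 * b) * π
      + algebraMap k L (3 * c) = 0) : ¬ HigherUnitsAreNorms V L 1 := by
  intro hall
  -- `4` lies in `1 + 3 𝒪` but is not `±1` modulo nine.
  have h4 : V (4 : k) = 1 := by
    refine map_eq_one_of_map_sub_lt_one (u := 1) (by simp) ?_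
    rw [V.map_sub_swap, show (4 : k) - 1 = 3 by norm_num]
    exact hV.map_three_lt_one
  obtain ⟨y, hy⟩ := hall 4 h4 (by
    rw [show (4 : k) - 1 = 3 by norm_num, hV.map_three]; simp)
  obtain ⟨p, q, r, rfl⟩ := exists_coords hL hπ y
  rw [norm_eq_cubicNormForm hL hπ hroot] at hy
  obtain ⟨hp, hq, hr⟩ := hV.integral_of_cubicNormForm hc (hy ▸ h4.le)
  have hy' : cubicNormForm (3 * a) (9 * b) (3 * c) (⟨p, hp⟩ : V.integer) ⟨q, hq⟩ ⟨r, hr⟩ = 4 :=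
    Subtype.ext (by simpa [cubicNormForm] using hy)
  have h43 : ¬ (3 : V.integer) ∣ 4 := by
    rw [hV.three_dvd_iff]
    push_cast
    rw [h4]
    exact lt_irrefl _
  have h9 : ¬ (9 : V.integer) ∣ 3 := by
    rintro ⟨z, hz⟩
    refine hV.prime_three.not_isUnit (.of_mul_eq_one z (mul_left_cancel₀ hV.prime_three.ne_zero ?_))
    linear_combination -hz
  rcases nine_dvd_cubicNormForm hV.residue_integer (b := b) (p := ⟨p, hp⟩) (q := ⟨q, hq⟩)
    (r := ⟨r, hr⟩) hac (by rwa [hy']) with h | h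
  · rw [hy'] at h
    exact h9 (h.trans (dvd_of_eq (by norm_num)))
  · rw [hy'] at h
    refine h43 ?_
    obtain ⟨z, hz⟩ := h
    exact ⟨4 * (2 - 3 * z), by linear_combination -4 * hz⟩

theorem exists_cube_eq_one_add_nine_mul (hV : IsThreeAdic V) (H : CubicHensel V) {x : k} (hx : V x ≤ 1) :
    ∃ y, y ^ 3 = 1 + 9 * x := by
  have hX : ∀ z : V.integer, V (z : k) ≤ 1 := fun z ↦ z.2
  let X : V.integer := ⟨x, hx⟩
  obtain ⟨h, -, hh⟩ := H (3 * x ^ 3 + 3 * x ^ 2) (1 + 6 * x + 9 * x ^ 2) (3 + 9 * x) 3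
    (by
      have : 3 ∣ 3 * X ^ 3 + 3 * X ^ 2 := ⟨X ^ 3 + X ^ 2, by ring⟩
      simpa [X] using hV.three_dvd_iff.mp this)
    (by
      refine map_eq_one_of_map_sub_lt_one (u := 1) (by simp) ?_
      have : 3 ∣ 1 - (1 + 6 * X + 9 * X ^ 2) := ⟨-(2 * X + 3 * X ^ 2), by ring⟩
      simpa [X] using hV.three_dvd_iff.mp this)
    (by simpa [X] using hX (3 + 9 * X)) (by simpa using hX 3)
  exact ⟨1 + 3 * (x + h), by linear_combination 9 * hh⟩

/-- The elements of `1 + 9 𝒪` are cubes, hence norms from any cubic extension. -/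
theorem higherUnitsAreNorms_two (hV : IsThreeAdic V) (H : CubicHensel V) (hL : Module.finrank k L = 3) :
    HigherUnitsAreNorms V L 2 := by
  intro u _ hu
  obtain ⟨x, hx, hux⟩ := hV.exists_eq_mul 2 hu
  obtain ⟨y, hy⟩ := hV.exists_cube_eq_one_add_nine_mul H hx
  exact exists_norm_eq_of_cube hL (x := y) (by linear_combination hy - hux)

/-- Units are `±1` modulo three and `-1 = N(-1)`, so only the units congruent to `1` matter, and only
up to sign. -/
theorem higherUnitsAreNorms_zero (hV : IsThreeAdic V) (hL : Module.finrank k L = 3)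
    (h : ∀ u : k, V (u - 1) < 1 → ∃ y : L, Algebra.norm k y = u ∨ Algebra.norm k y = -u) :
    HigherUnitsAreNorms V L 0 := by
  have hneg : ∀ y : L, Algebra.norm k (-y) = -Algebra.norm k y := by
    intro y
    have : Algebra.norm k (-1 : L) = -1 := by
      have := Algebra.norm_algebraMap (S := L) (-1 : k)
      rw [hL] at this
      simpa [Odd.neg_pow (show Odd 3 by decide)] using this
    rw [← neg_one_mul, map_mul, this, neg_one_mul]
  have h' : ∀ u : k, V (u - 1) < 1 → ∃ y : L, Algebra.norm k y = u := by
    intro u hu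
    obtain ⟨y, hy | hy⟩ := h u hu
    · exact ⟨y, hy⟩
    · exact ⟨-y, by rw [hneg, hy, neg_neg]⟩
  intro u hu _
  rcases hV.residue u hu.le with h1 | h1 | h1
  · exact absurd hu h1.ne
  · exact h' u h1
  · obtain ⟨y, hy⟩ := h' (-u) (by rwa [← V.map_neg, neg_sub, sub_neg_eq_add, add_comm])
    exact ⟨-y, by rw [hneg, hy, neg_neg]⟩

/-- If `t` is not integral, then one root of `g(x; t)` is close to `0`, so all are rational. -/
theorem higherUnitsAreNorms_zero_of_one_lt (hV : IsThreeAdic V) (H : CubicHensel V) {t : k}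
    {α : L} (hα : α ^ 3 + algebraMap k L t * α ^ 2 - (algebraMap k L t + 3) * α + 1 = 0)
    (htop : IntermediateField.adjoin k {α} = ⊤) (ht : 1 < V t) : HigherUnitsAreNorms V L 0 := by
  have ht0 : t ≠ 0 := by rintro rfl; simp at ht
  have hτ : V t⁻¹ < 1 := by
    rw [map_inv₀]
    exact inv_lt_one_of_one_lt₀ ht
  obtain ⟨x, -, hx⟩ := H t⁻¹ (-(1 + 3 * t⁻¹)) 1 t⁻¹ hτ
    (by
      rw [V.map_neg]
      refine map_eq_one_of_map_sub_lt_one (u := 1) (by simp) ?_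
      rw [sub_add_cancel_left, V.map_neg, map_mul]
      exact mul_lt_one_of_nonneg_of_lt_one_left zero_le hV.map_three_lt_one hτ.le)
    (by simp) hτ.le
  have hx' : x ^ 3 + t * x ^ 2 - (t + 3) * x + 1 = 0 := by
    have := congrArg (t * ·) hx
    field_simp at this
    linear_combination this
  rcases bijective_or_finrank_eq_three hα htop with hbij | ⟨-, hαk⟩
  · exact .zero_of_bijective hbij
  · exact absurd (mem_range_of_root hx' hα) hαk

/-- If `t` is a unit, then the units congruent to `1` are norms of elements `1 - μ α`. -/
theorem higherUnitsAreNorms_zero_of_eq_one (hV : IsThreeAdic V) (H : CubicHensel V) {t : k}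
    {α : L} (hα : α ^ 3 + algebraMap k L t * α ^ 2 - (algebraMap k L t + 3) * α + 1 = 0)
    (htop : IntermediateField.adjoin k {α} = ⊤) (ht : V t = 1) : HigherUnitsAreNorms V L 0 := by
  rcases bijective_or_finrank_eq_three hα htop with hbij | ⟨hL, hαk⟩
  · exact .zero_of_bijective hbij
  refine hV.higherUnitsAreNorms_zero hL fun u hu ↦ ?_
  obtain ⟨μ, -, hμ⟩ := H (1 - u) t (-(t + 3)) 1 (by rwa [V.map_sub_swap]) ht
    (by rw [V.map_neg]; exact V.map_add_le ht.le hV.map_three_lt_one.le) (by simp)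
  refine ⟨_, .inl ((norm_eq_cubicNormForm hL hαk (a := t) (b := -(t + 3)) (c := 1)
    (by simp only [map_neg, map_add, map_ofNat, map_one]; linear_combination hα)
    1 (-μ) 0).trans ?_)⟩
  rw [cubicNormForm]
  linear_combination hμ

/-- A root `π` of an Eisenstein cubic forces `L / k` to be ramified of degree three. The congruence
`a + c ≡ 0`, which reflects that `L / k` is cyclic, makes the conductor exponent equal to `2`. -/
theorem conductor_two (hV : IsThreeAdic V) (H : CubicHensel V) {a b c : V.integer}
    (hc : ¬ 3 ∣ c) (hac : 3 ∣ a + c)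
    (hL : Function.Bijective (algebraMap k L) ∨ Module.finrank k L = 3) {π : L}
    (hroot : π ^ 3 + algebraMap k L (3 * a) * π ^ 2 + algebraMap k L (9 * b) * π
      + algebraMap k L (3 * c) = 0) :
    HigherUnitsAreNorms V L 2 ∧ ¬ HigherUnitsAreNorms V L 1 := by
  have hπ : π ∉ Set.range (algebraMap k L) := by
    rintro ⟨x, rfl⟩
    refine hV.eisenstein_no_root (a := a) (b := b) hc x ?_
    apply (algebraMap k L).injective
    simpa using hroot
  have hL3 : Module.finrank k L = 3 := hL.resolve_left fun h ↦ hπ (h.2 π)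
  exact ⟨hV.higherUnitsAreNorms_two H hL3,
    hV.not_higherUnitsAreNorms_one hc hac hL3 hπ hroot⟩

/-- The ramified case `t = 3 s` with `s ≢ 1`: here `α + 1` is a root of an Eisenstein cubic. -/
theorem conductor_two_of_ne_one (hV : IsThreeAdic V) (H : CubicHensel V) {s : V.integer}
    {α : L} (hα : α ^ 3 + algebraMap k L (3 * s) * α ^ 2 - (algebraMap k L (3 * s) + 3) * α + 1 = 0)
    (htop : IntermediateField.adjoin k {α} = ⊤) (hs : ¬ 3 ∣ s - 1) :
    HigherUnitsAreNorms V L 2 ∧ ¬ HigherUnitsAreNorms V L 1 := by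
  refine hV.conductor_two H (a := s - 1) (b := -s) (c := 2 * s + 1) ?_ ⟨s, by ring⟩
    ((bijective_or_finrank_eq_three hα htop).imp_right And.left) (π := α + 1) ?_
  · rintro ⟨z, hz⟩
    exact hs ⟨s - z, by linear_combination -hz⟩
  · simp [map_ofNat] at hα ⊢
    linear_combination hα

/-- The ramified case `t = 3 + 9 r` with `r ≢ 1`: here `3 (1 + 2 r) / (α + 1)` is a root of an
Eisenstein cubic. -/
theorem conductor_two_of_eq_one (hV : IsThreeAdic V) (H : CubicHensel V) {r : V.integer}
    {α : L} (hα : α ^ 3 + algebraMap k L (3 + 9 * r) * α ^ 2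
      - (algebraMap k L (3 + 9 * r) + 3) * α + 1 = 0)
    (htop : IntermediateField.adjoin k {α} = ⊤) (hr : ¬ 3 ∣ r - 1) :
    HigherUnitsAreNorms V L 2 ∧ ¬ HigherUnitsAreNorms V L 1 := by
  have h2r : ¬ 3 ∣ 1 + 2 * r := by
    rintro ⟨z, hz⟩
    exact hr ⟨r - z, by linear_combination -hz⟩
  refine hV.conductor_two H (a := -(1 + 3 * r)) (b := r * (1 + 2 * r)) (c := (1 + 2 * r) ^ 2)
    (fun h ↦ h2r (hV.prime_three.dvd_of_dvd_pow h)) ?_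
    ((bijective_or_finrank_eq_three hα htop).imp_right And.left)
    (π := algebraMap k L (3 * (1 + 2 * r)) / (α + 1)) ?_
  · rcases (hV.residue_integer r) with ⟨z, hz⟩ | h | ⟨z, hz⟩
    · exact ⟨z + 4 * r * z, by linear_combination (1 + 4 * r) * hz⟩
    · exact absurd h hr
    · exact ⟨-r + 4 * r * z, by linear_combination (4 * r) * hz⟩
  · set φ := algebraMap k L
    have hc : φ (1 + 2 * r) ≠ 0 := by
      rw [Ne, map_eq_zero]
      exact fun h ↦ h2r (by rw [show 1 + 2 * r = 0 from Subtype.ext (by simpa using h)]; simp)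
    have h3 : (3 : L) ≠ 0 := by
      rw [← map_ofNat φ 3]
      exact (map_ne_zero φ).mpr hV.three_ne_zero
    have hα1 : α + 1 ≠ 0 := by
      intro h
      obtain rfl : α = -1 := by linear_combination h
      have : (3 : L) ^ 2 * φ (1 + 2 * r) = 0 := by
        simp only [map_add, map_mul, map_ofNat, map_one] at hα ⊢
        linear_combination hα
      exact mul_ne_zero (pow_ne_zero 2 h3) hc this
    simp only [map_add, map_mul, map_ofNat, map_one] at hα hc ⊢
    push_cast
    simp only [map_add, map_mul, map_pow, map_neg, map_ofNat, map_one]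
    field_simp
    linear_combination 3 * (1 + 2 * φ r) ^ 2 * hα

/-- The unramified case `t = 3 + 9 r` with `r ≡ 1`: here `z = (α + 1) / 3` is a root of
`f = X³ + 3 r X² - (1 + 3 r) X + c`, which is an Artin–Schreier polynomial modulo three, and
`f(x)` is the norm of `x - z`. -/
theorem higherUnitsAreNorms_zero_of_eq_one_of_eq_one (hV : IsThreeAdic V) (H : CubicHensel V)
    {r : V.integer} {α : L} (hα : α ^ 3 + algebraMap k L (3 + 9 * r) * α ^ 2
      - (algebraMap k L (3 + 9 * r) + 3) * α + 1 = 0)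
    (htop : IntermediateField.adjoin k {α} = ⊤) (hr : 3 ∣ r - 1) :
    HigherUnitsAreNorms V L 0 := by
  rcases bijective_or_finrank_eq_three hα htop with hbij | ⟨hL, hαk⟩
  · exact .zero_of_bijective hbij
  obtain ⟨c, hc⟩ : 3 ∣ 1 + 2 * r := by
    obtain ⟨z, hz⟩ := hr
    exact ⟨1 + 2 * z, by linear_combination 2 * hz⟩
  set φ := algebraMap k L with hφ
  have h3 : (3 : L) ≠ 0 := by
    rw [← map_ofNat φ 3]
    exact (map_ne_zero φ).mpr hV.three_ne_zero
  have hck : 1 + 2 * (r : k) = 3 * c := by simpa using congrArg Subtype.val hc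
  have hcL : 1 + 2 * φ r = 3 * φ c := by simpa [map_ofNat] using congrArg φ hck
  obtain ⟨z, hz⟩ : ∃ z, α = 3 * z - 1 := ⟨(α + 1) / 3, by field_simp; ring⟩
  have hzk : z ∉ Set.range φ := by
    rintro ⟨x, rfl⟩
    exact hαk ⟨3 * x - 1, by simp [hz, hφ, map_ofNat]⟩
  have hroot : z ^ 3 + φ (3 * r) * z ^ 2 + φ (-(1 + 3 * r)) * z + φ c = 0 := by
    apply mul_left_cancel₀ (pow_ne_zero 3 h3)
    subst hz
    simp only [map_add, map_mul, map_neg, map_ofNat, map_one] at hα ⊢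
    linear_combination hα - 9 * hcL
  have hnorm : ∀ x : k, Algebra.norm k (φ x + φ (-1) * z + φ 0 * z ^ 2) =
      x ^ 3 + 3 * r * x ^ 2 - (1 + 3 * r) * x + c := by
    intro x
    rw [norm_eq_cubicNormForm hL hzk hroot, cubicNormForm]
    ring
  have hens : ∀ w : k, V (w - c) < 1 → ∃ y : L, Algebra.norm k y = w := by
    intro w hw
    obtain ⟨x, -, hx⟩ := H (c - w) (-(1 + 3 * r)) (3 * r) 1 (by rwa [V.map_sub_swap])
      (by
        rw [V.map_neg]
        refine map_eq_one_of_map_sub_lt_one (u := 1) (by simp) ?_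
        rw [sub_add_cancel_left, V.map_neg, map_mul]
        exact mul_lt_one_of_nonneg_of_lt_one_left zero_le hV.map_three_lt_one r.2)
      (3 * r).2 (by simp)
    exact ⟨_, (hnorm x).trans (by linear_combination hx)⟩
  refine hV.higherUnitsAreNorms_zero hL fun u hu ↦ ?_
  rcases hV.residue_integer c with h | h | h
  · -- The polynomial has a root modulo three, hence a root.
    exfalso
    obtain ⟨x, -, hx⟩ := H c (-(1 + 3 * r)) (3 * r) 1 (hV.three_dvd_iff.mp h)
      (by
        rw [V.map_neg]
        refine map_eq_one_of_map_sub_lt_one (u := 1) (by simp) ?_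
        rw [sub_add_cancel_left, V.map_neg, map_mul]
        exact mul_lt_one_of_nonneg_of_lt_one_left zero_le hV.map_three_lt_one r.2)
      (3 * r).2 (by simp)
    refine hαk (mem_range_of_root (t := 3 + 9 * (r : k)) (x := 3 * x - 1) ?_ hα)
    linear_combination 27 * hx + 9 * hck
  · obtain ⟨y, hy⟩ := hens u (by
      have := V.map_sub_lt hu (hV.three_dvd_iff.mp h)
      simpa using this)
    exact ⟨y, .inl hy⟩
  · obtain ⟨y, hy⟩ := hens (-u) (by
      have := V.map_add_lt hu (hV.three_dvd_iff.mp h)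
      rw [← V.map_neg]
      convert this using 2
      push_cast
      ring)
    exact ⟨y, .inr hy⟩

theorem delta_lt_one_iff (hV : IsThreeAdic V) {t : k} :
    V (t ^ 2 + 3 * t + 9) < 1 ↔ V t < 1 := by
  have h3 := hV.map_three_lt_one
  have h9 : V (9 : k) < 1 := by
    rw [show (9 : k) = 3 * 3 by norm_num, map_mul]
    exact mul_lt_one_of_nonneg_of_lt_one_left zero_le h3 h3.le
  constructor
  · intro h
    by_contra! ht
    have h1 : V (3 * t + 9) < V (t ^ 2) := by
      refine V.map_add_lt ?_ (h9.trans_le (by rw [map_pow]; exact one_le_pow₀ ht))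
      rw [map_mul, map_pow, pow_two]
      exact mul_lt_mul_of_pos_right (h3.trans_le ht) (zero_lt_one.trans_le ht)
    rw [add_assoc, V.map_add_eq_of_lt_left h1, map_pow] at h
    exact absurd h (not_lt.mpr (one_le_pow₀ ht))
  · intro h
    refine V.map_add_lt (V.map_add_lt ?_ ?_) h9
    · rw [map_pow]
      exact pow_lt_one₀ zero_le h two_ne_zero
    · rw [map_mul]
      exact mul_lt_one_of_nonneg_of_lt_one_left zero_le h3 h.le

theorem wild_of_one_le_delta (hV : IsThreeAdic V) (H : CubicHensel V) {t : k}
    {α : L} (hα : α ^ 3 + algebraMap k L t * α ^ 2 - (algebraMap k L t + 3) * α + 1 = 0)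
    (htop : IntermediateField.adjoin k {α} = ⊤) (hδ : 1 ≤ V (t ^ 2 + 3 * t + 9)) :
    HigherUnitsAreNorms V L 0 := by
  rw [← not_lt, hV.delta_lt_one_iff, not_lt] at hδ
  rcases hδ.eq_or_lt with h | h
  · exact hV.higherUnitsAreNorms_zero_of_eq_one H hα htop h.symm
  · exact hV.higherUnitsAreNorms_zero_of_one_lt H hα htop h

/-- In the case `t = 3 s` with `s ≢ 1` the order of `δ` is `2`. -/
theorem map_delta_of_ne_one (hV : IsThreeAdic V) {s : V.integer} (hs : ¬ 3 ∣ s - 1) (x : k) :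
    V ((3 * s : k) ^ 2 + 3 * (3 * s) + 9) ≠ V x ^ 3 := by
  have h1 : V ((s : k) ^ 2 + s + 1) = 1 := by
    have hs' : ¬ 3 ∣ s ^ 2 + s + 1 := by
      intro h
      refine hs (hV.prime_three.dvd_of_dvd_pow (n := 2) ?_)
      obtain ⟨z, hz⟩ := h
      exact ⟨z - s, by linear_combination hz⟩
    rw [hV.three_dvd_iff, not_lt] at hs'
    exact le_antisymm (s ^ 2 + s + 1).2 hs'
  rw [show (3 * s : k) ^ 2 + 3 * (3 * s) + 9 = 3 ^ 2 * (s ^ 2 + s + 1) by ring, map_mul, map_pow,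
    h1, mul_one, hV.map_three, ← WithZero.exp_nsmul]
  intro h
  have := congrArg WithZero.log h
  rw [WithZero.log_exp, WithZero.log_pow] at this
  simp at this
  omega

theorem delta_eq_mul (r : k) :
    (3 + 9 * r) ^ 2 + 3 * (3 + 9 * r) + 9 = 3 ^ 3 * (1 + 3 * r + 3 * r ^ 2) := by
  ring

/-- In the case `t = 3 + 9 r` the order of `δ` is `3`. -/
theorem map_delta_of_eq_one (hV : IsThreeAdic V) (r : V.integer) :
    V ((3 + 9 * r : k) ^ 2 + 3 * (3 + 9 * r) + 9) = V 3 ^ 3 := by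
  have h1 : V (1 + 3 * (r : k) + 3 * r ^ 2) = 1 := by
    refine map_eq_one_of_map_sub_lt_one (u := 1) (by simp) ?_
    have : 3 ∣ 1 - (1 + 3 * r + 3 * r ^ 2) := ⟨-(r + r ^ 2), by ring⟩
    simpa using hV.three_dvd_iff.mp this
  rw [delta_eq_mul, map_mul, map_pow, h1, mul_one]

/-- The unit `1 + 3 r + 3 r²` is `1` modulo nine if `r ≢ 1`, and `7` otherwise. -/
theorem delta_cube_iff (hV : IsThreeAdic V) (H : CubicHensel V) (r : V.integer) :
    (∃ y : k, y ^ 3 = (3 + 9 * r : k) ^ 2 + 3 * (3 + 9 * r) + 9) ↔ ¬ 3 ∣ r - 1 := by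
  rw [delta_eq_mul]
  constructor
  · rintro ⟨y, hy⟩ ⟨z, hz⟩
    have h3 := hV.three_ne_zero
    obtain ⟨x, hx⟩ : ∃ x, y = 3 * x := ⟨y / 3, by field_simp⟩
    have hx3 : x ^ 3 = 1 + 3 * r + 3 * r ^ 2 := by
      apply mul_left_cancel₀ (pow_ne_zero 3 h3)
      rw [← hy, hx]
      ring
    have hxi : V x ≤ 1 := by
      have h1 : V x ^ 3 ≤ 1 := by
        rw [← map_pow, hx3]
        exact (1 + 3 * r + 3 * r ^ 2).2
      exact (pow_le_one_iff_of_nonneg zero_le (by norm_num)).mp h1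
    obtain ⟨X, rfl⟩ : ∃ X : V.integer, (X : k) = x := ⟨⟨x, hxi⟩, rfl⟩
    have hX : X ^ 3 = 1 + 3 * r + 3 * r ^ 2 := Subtype.ext (by simpa using hx3)
    have h9 : ¬ (9 : V.integer) ∣ 3 := by
      rintro ⟨z, hz⟩
      refine hV.prime_three.not_isUnit
        (.of_mul_eq_one z (mul_left_cancel₀ hV.prime_three.ne_zero ?_))
      linear_combination -hz
    obtain rfl : r = 1 + 3 * z := by linear_combination hz
    have hX1 : 3 ∣ X - 1 := by
      have h := three_dvd_cube_sub hV.residue_integer X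
      rw [hX] at h
      obtain ⟨w, hw⟩ := h
      exact ⟨2 + 9 * z + 9 * z ^ 2 - w, by linear_combination -hw⟩
    obtain ⟨w, hw⟩ := nine_dvd_cube_sub_one hX1
    rw [hX] at hw
    exact h9 ⟨1 + 3 * z + 3 * z ^ 2 - w, by linear_combination -hw⟩
  · intro hr
    obtain ⟨x, hx⟩ : 3 ∣ r + r ^ 2 := by
      rcases hV.residue_integer r with ⟨z, hz⟩ | h | ⟨z, hz⟩
      · exact ⟨z * (1 + r), by linear_combination (1 + r) * hz⟩
      · exact absurd h hr
      · exact ⟨z * r, by linear_combination r * hz⟩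
    obtain ⟨y, hy⟩ := hV.exists_cube_eq_one_add_nine_mul H x.2
    have hx' : (r : k) + r ^ 2 = 3 * x := by simpa using congrArg Subtype.val hx
    exact ⟨3 * y, by linear_combination 27 * hy - 81 * hx'⟩

theorem exists_of_delta_lt_one (hV : IsThreeAdic V) {t : k} (hδ : V (t ^ 2 + 3 * t + 9) < 1) :
    (∃ s : V.integer, t = 3 * s ∧ ¬ 3 ∣ s - 1) ∨ ∃ r : V.integer, t = 3 + 9 * r := by
  obtain ⟨s, hs, rfl⟩ := hV.exists_eq_three_mul (hV.delta_lt_one_iff.mp hδ)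
  obtain ⟨S, rfl⟩ : ∃ S : V.integer, (S : k) = s := ⟨⟨s, hs⟩, rfl⟩
  by_cases h : 3 ∣ S - 1
  · obtain ⟨r, hr⟩ := h
    obtain rfl : S = 1 + 3 * r := by linear_combination hr
    exact .inr ⟨r, by push_cast; ring⟩
  · exact .inl ⟨S, rfl, h⟩

theorem wild_of_not_cube_value (hV : IsThreeAdic V) (H : CubicHensel V) {t : k}
    {α : L} (hα : α ^ 3 + algebraMap k L t * α ^ 2 - (algebraMap k L t + 3) * α + 1 = 0)
    (htop : IntermediateField.adjoin k {α} = ⊤) (hδ : V (t ^ 2 + 3 * t + 9) < 1)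
    (hδ3 : ∀ x, V (t ^ 2 + 3 * t + 9) ≠ V x ^ 3) :
    HigherUnitsAreNorms V L 2 ∧ ¬ HigherUnitsAreNorms V L 1 := by
  rcases hV.exists_of_delta_lt_one hδ with ⟨s, rfl, hs⟩ | ⟨r, rfl⟩
  · exact hV.conductor_two_of_ne_one H hα htop hs
  · exact absurd (hV.map_delta_of_eq_one r) (hδ3 3)

theorem wild_of_cube_value (hV : IsThreeAdic V) (H : CubicHensel V) {t : k}
    {α : L} (hα : α ^ 3 + algebraMap k L t * α ^ 2 - (algebraMap k L t + 3) * α + 1 = 0)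
    (htop : IntermediateField.adjoin k {α} = ⊤) (hδ : V (t ^ 2 + 3 * t + 9) < 1)
    {x : k} (hx : V (t ^ 2 + 3 * t + 9) = V x ^ 3) :
    ((¬ ∃ y : k, y ^ 3 = t ^ 2 + 3 * t + 9) → HigherUnitsAreNorms V L 0) ∧
    ((∃ y : k, y ^ 3 = t ^ 2 + 3 * t + 9) →
      HigherUnitsAreNorms V L 2 ∧ ¬ HigherUnitsAreNorms V L 1) := by
  rcases hV.exists_of_delta_lt_one hδ with ⟨s, rfl, hs⟩ | ⟨r, rfl⟩
  · exact absurd hx (hV.map_delta_of_ne_one hs x)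
  · rw [hV.delta_cube_iff H, not_not]
    exact ⟨hV.higherUnitsAreNorms_zero_of_eq_one_of_eq_one H hα htop,
      hV.conductor_two_of_eq_one H hα htop⟩

end IsThreeAdic

end Wild

/-! ### The completion of a number field -/

/-- If every integer of a valued field is congruent to an element of a subring whose reduction is
finite, then the residue field is finite. -/
theorem finite_residueField {R k Γ : Type*} [CommRing R] [Field k]
    [LinearOrderedCommGroupWithZero Γ] (V : Valuation k Γ) (f : R →+* k) (I : Ideal R)
    [Finite (R ⧸ I)] (hle : ∀ x, V (f x) ≤ 1) (hlt : ∀ x ∈ I, V (f x) < 1)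
    (happrox : ∀ x, V x ≤ 1 → ∃ y, V (x - f y) < 1) :
    Finite (IsLocalRing.ResidueField V.valuationSubring) := by
  let φ : R →+* IsLocalRing.ResidueField V.valuationSubring :=
    (IsLocalRing.residue V.valuationSubring).comp (f.codRestrict V.valuationSubring hle)
  have hφ : ∀ x ∈ I, φ x = 0 := fun x hx ↦ (residue_eq_zero_iff V _).mpr (hlt x hx)
  refine Finite.of_surjective (Ideal.Quotient.lift I φ hφ) fun z ↦ ?_
  obtain ⟨x, rfl⟩ := IsLocalRing.residue_surjective z
  obtain ⟨y, hy⟩ := happrox x x.2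
  exact ⟨Ideal.Quotient.mk I y, ((residue_eq_iff V x (f.codRestrict V.valuationSubring hle y)).mpr
    hy).symm⟩

section Completion

variable {F : Type*} [Field F] [NumberField F] (v : HeightOneSpectrum (𝓞 F))

open scoped Valued in
/-- The map `h ↦ -(c₀ + c₂ h² + c₃ h³) / c₁` contracts the ball of radius `‖c₀‖`, and its fixed point
is the root. -/
theorem cubicHensel_completion :
    CubicHensel (Valued.v : Valuation (v.adicCompletion F) ℤᵐ⁰) := by
  intro c₀ c₁ c₂ c₃ h₀ h₁ h₂ h₃
  have nlt : ∀ x : v.adicCompletion F, ‖x‖ < 1 ↔ Valued.v x < 1 := fun x ↦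
    Valued.toNormedField.norm_lt_one_iff
  have nle : ∀ x : v.adicCompletion F, ‖x‖ ≤ 1 ↔ Valued.v x ≤ 1 := fun x ↦
    Valued.toNormedField.norm_le_one_iff
  have hc₁ : ‖c₁‖ = 1 := le_antisymm ((nle _).mpr h₁.le)
    (Valued.toNormedField.one_le_norm_iff.mpr h₁.ge)
  have hc₁0 : c₁ ≠ 0 := by rintro rfl; simp at h₁
  rw [← nlt] at h₀
  rw [← nle] at h₂ h₃
  set ρ := ‖c₀‖ with hρ
  have hρ0 : 0 ≤ ρ := norm_nonneg _
  let T : v.adicCompletion F → v.adicCompletion F := fun h ↦ -(c₀ + c₂ * h ^ 2 + c₃ * h ^ 3) / c₁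
  have hT : ∀ h, ‖h‖ ≤ ρ → ‖T h‖ ≤ ρ := by
    intro h hh
    have hh1 : ‖h‖ ≤ 1 := hh.trans h₀.le
    simp only [T]
    rw [norm_div, hc₁, div_one, norm_neg]
    refine (IsUltrametricDist.norm_add_le_max _ _).trans (max_le
      ((IsUltrametricDist.norm_add_le_max _ _).trans (max_le le_rfl ?_)) ?_)
    · rw [norm_mul, norm_pow]
      calc ‖c₂‖ * ‖h‖ ^ 2 ≤ 1 * ‖h‖ ^ 1 := by
            gcongr ?_ * ?_
            exact pow_le_pow_of_le_one (norm_nonneg _) hh1 (by norm_num)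
        _ ≤ ρ := by simpa using hh
    · rw [norm_mul, norm_pow]
      calc ‖c₃‖ * ‖h‖ ^ 3 ≤ 1 * ‖h‖ ^ 1 := by
            gcongr ?_ * ?_
            exact pow_le_pow_of_le_one (norm_nonneg _) hh1 (by norm_num)
        _ ≤ ρ := by simpa using hh
  have hTT : ∀ x y, ‖x‖ ≤ ρ → ‖y‖ ≤ ρ → ‖T x - T y‖ ≤ ρ * ‖x - y‖ := by
    intro x y hx hy
    have : T x - T y = -((c₂ * (x + y) + c₃ * (x ^ 2 + x * y + y ^ 2)) * (x - y)) / c₁ := by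
      simp only [T]
      field_simp
      ring
    rw [this, norm_div, hc₁, div_one, norm_neg, norm_mul]
    gcongr
    have aux : ∀ z w : v.adicCompletion F, ‖z‖ ≤ ρ → ‖w‖ ≤ 1 → ‖z * w‖ ≤ ρ := by
      intro z w hz hw
      rw [norm_mul]
      exact (mul_le_of_le_one_right (norm_nonneg _) hw).trans hz
    have add : ∀ z w : v.adicCompletion F, ‖z‖ ≤ ρ → ‖w‖ ≤ ρ → ‖z + w‖ ≤ ρ := fun z w hz hw ↦
      (IsUltrametricDist.norm_add_le_max _ _).trans (max_le hz hw)
    have hx1 := hx.trans h₀.le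
    have hy1 := hy.trans h₀.le
    refine add _ _ ?_ ?_
    · rw [mul_comm]
      exact aux _ _ (add _ _ hx hy) h₂
    · rw [mul_comm]
      refine aux _ _ (add _ _ (add _ _ ?_ ?_) ?_) h₃
      · rw [pow_two]; exact aux _ _ hx hx1
      · exact aux _ _ hx hy1
      · rw [pow_two]; exact aux _ _ hy hy1
  let s : ℕ → v.adicCompletion F := fun n ↦ T^[n] 0
  have hs : ∀ n, ‖s n‖ ≤ ρ := by
    intro n
    induction n with
    | zero => simpa [s] using hρ0
    | succ n ih =>
      simp only [s, Function.iterate_succ_apply']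
      exact hT _ ih
  have hdist : ∀ n, dist (s n) (s (n + 1)) ≤ ρ * ρ ^ n := by
    intro n
    induction n with
    | zero => simpa [s, dist_eq_norm] using hT 0 (by simpa using hρ0)
    | succ n ih =>
      have h1 : s (n + 1) = T (s n) := Function.iterate_succ_apply' ..
      have h2 : s (n + 1 + 1) = T (s (n + 1)) := Function.iterate_succ_apply' ..
      rw [h2, h1, dist_eq_norm]
      refine (hTT _ _ (hs n) (hT _ (hs n))).trans ?_
      rw [← h1, ← dist_eq_norm, pow_succ']
      gcongr
  have hcauchy : CauchySeq s := cauchySeq_of_le_geometric ρ ρ h₀ hdist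
  obtain ⟨h, hh⟩ := cauchySeq_tendsto_of_complete hcauchy
  have hhρ : ‖h‖ ≤ ρ := le_of_tendsto hh.norm (.of_forall hs)
  have hTc : Continuous T := by fun_prop
  have hfix : T h = h := by
    refine tendsto_nhds_unique ?_ ((Filter.tendsto_add_atTop_iff_nat 1).mpr hh)
    have : (fun n ↦ s (n + 1)) = fun n ↦ T (s n) :=
      funext fun n ↦ Function.iterate_succ_apply' ..
    rw [this]
    exact (hTc.tendsto h).comp hh
  refine ⟨h, (nlt _).mp (hhρ.trans_lt h₀), ?_⟩
  simp only [T] at hfix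
  rw [div_eq_iff hc₁0] at hfix
  linear_combination -hfix

open scoped Valued in
/-- Every integer of the completion is congruent to a global integer. -/
theorem exists_integer_sub_lt_one {x : v.adicCompletion F} (hx : Valued.v x ≤ 1) :
    ∃ y : 𝓞 F, Valued.v (x - algebraMap F (v.adicCompletion F) y) < 1 := by
  have hopen : IsOpen {z : v.adicCompletion F | ‖x - z‖ < 1} :=
    isOpen_lt (by fun_prop) continuous_const
  obtain ⟨z, hz⟩ := (v.denseRange_algebraMap F).exists_mem_open hopen ⟨x, by simp⟩
  have hxz : Valued.v (x - algebraMap F (v.adicCompletion F) z) < 1 :=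
    Valued.toNormedField.norm_lt_one_iff.mp hz
  have hz1 : v.valuation F z ≤ 1 := by
    rw [← HeightOneSpectrum.valuedAdicCompletion_eq_valuation']
    have := Valued.v.map_sub_le hx hxz.le
    rwa [sub_sub_cancel] at this
  obtain ⟨y, hy⟩ := v.exists_valuation_sub_lt_of_integer hz1 1
  refine ⟨y, ?_⟩
  have hzy : Valued.v (algebraMap F (v.adicCompletion F) (algebraMap (𝓞 F) F y - z)) < 1 := by
    rw [← Units.val_one]
    exact (HeightOneSpectrum.valuedAdicCompletion_eq_valuation' v _).trans_lt hy
  have := Valued.v.map_sub_lt hxz hzy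
  rw [map_sub (algebraMap F _)] at this
  rwa [sub_sub_sub_cancel_right] at this

theorem valued_algebraMap (x : F) :
    Valued.v (algebraMap F (v.adicCompletion F) x) = v.valuation F x :=
  HeightOneSpectrum.valuedAdicCompletion_eq_valuation' v x

theorem valued_integer_lt_one_iff (x : 𝓞 F) :
    Valued.v (algebraMap F (v.adicCompletion F) x) < 1 ↔ x ∈ v.asIdeal := by
  rw [valued_algebraMap, ← HeightOneSpectrum.valuation_lt_one_iff_mem (K := F)]

instance finite_residueField_completion : Finite (IsLocalRing.ResidueField
    (Valued.v : Valuation (v.adicCompletion F) ℤᵐ⁰).valuationSubring) := by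
  have : Finite (𝓞 F ⧸ v.asIdeal) := Ideal.finiteQuotientOfFreeOfNeBot _ v.ne_bot
  refine finite_residueField Valued.v
    ((algebraMap F (v.adicCompletion F)).comp (algebraMap (𝓞 F) F)) v.asIdeal (fun x ↦ ?_)
    (fun x ↦ (valued_integer_lt_one_iff v x).mpr) fun x ↦ exists_integer_sub_lt_one v
  exact (valued_algebraMap v _).trans_le (v.valuation_le_one x)

theorem valued_three_eq_one (h : (3 : 𝓞 F) ∉ v.asIdeal) :
    Valued.v (3 : v.adicCompletion F) = 1 := by
  have h1 := (valued_integer_lt_one_iff v 3).not.mpr h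
  have h2 : Valued.v (algebraMap F (v.adicCompletion F) (3 : 𝓞 F)) ≤ 1 := by
    rw [valued_algebraMap]
    exact v.valuation_le_one _
  simpa [map_ofNat] using le_antisymm h2 (not_lt.mp h1)

theorem isThreeAdic_completion (h3 : ThreeSplitsCompletely F) (h : (3 : 𝓞 F) ∈ v.asIdeal) :
    IsThreeAdic (Valued.v : Valuation (v.adicCompletion F) ℤᵐ⁰) := by
  have hmax : (Ideal.span {(3 : ℤ)}).IsMaximal :=
    PrincipalIdealRing.isMaximal_of_irreducible Int.prime_three.irreducible
  have hle : Ideal.span {(3 : ℤ)} ≤ v.asIdeal.under ℤ := by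
    rw [Ideal.span_singleton_le_iff_mem, Ideal.mem_comap, map_ofNat]
    exact h
  have hne : v.asIdeal.under ℤ ≠ ⊤ := Ideal.comap_ne_top _ v.isPrime.ne_top
  have hover : v.asIdeal.LiesOver (Ideal.span {(3 : ℤ)}) := ⟨hmax.eq_of_le hne hle⟩
  obtain ⟨hram, hdeg⟩ := h3 v.asIdeal v.isPrime hover
  constructor
  · have h2 : (3 : 𝓞 F) ∉ v.asIdeal ^ 2 := by
      intro h2
      refine (Ideal.ramificationIdx'_ne_one_iff (Ideal.map_le_iff_le_comap.mpr hle)).mpr ?_ hram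
      rw [Ideal.map_span, Set.image_singleton, map_ofNat, Ideal.span_singleton_le_iff_mem]
      exact h2
    have h1 : v.intValuation (3 : 𝓞 F) ≤ WithZero.exp (-((1 : ℕ) : ℤ)) := by
      rw [v.intValuation_le_pow_iff_mem, pow_one]
      exact h
    rw [← v.intValuation_le_pow_iff_mem, not_le] at h2
    have h0 : v.intValuation (3 : 𝓞 F) ≠ 0 := (zero_le.trans_lt h2).ne'
    have : v.intValuation (3 : 𝓞 F) = WithZero.exp (-1) := by
      rw [← WithZero.exp_log h0] at h1 h2 ⊢
      rw [WithZero.exp_le_exp] at h1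
      rw [WithZero.exp_lt_exp] at h2
      congr 1
      push_cast at h1 h2
      omega
    rw [← this, ← v.valuation_of_algebraMap (K := F), ← valued_algebraMap]
    congr 1
    exact (map_ofNat ((algebraMap F (v.adicCompletion F)).comp (algebraMap (𝓞 F) F)) 3).symm
  · have hfin : Module.finrank (ℤ ⧸ Ideal.span {(3 : ℤ)}) (𝓞 F ⧸ v.asIdeal) = 1 := by
      rw [← hdeg, Ideal.inertiaDeg'_algebraMap]
    let _ := Ideal.Quotient.field (Ideal.span {(3 : ℤ)})
    have hsurj := (Algebra.finrank_eq_one_iff_bijective_algebraMap.mp hfin).2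
    intro x hx
    obtain ⟨y, hy⟩ := exists_integer_sub_lt_one v hx
    obtain ⟨n, hn⟩ : ∃ n : ℤ, y - n ∈ v.asIdeal := by
      obtain ⟨z, hz⟩ := hsurj (Ideal.Quotient.mk _ y)
      obtain ⟨n, rfl⟩ := Ideal.Quotient.mk_surjective z
      refine ⟨n, ?_⟩
      rw [← Ideal.Quotient.eq, ← hz]
      simp
    obtain ⟨e, he, hne⟩ : ∃ e : ℤ, (e = 0 ∨ e = 1 ∨ e = -1) ∧ (3 : ℤ) ∣ n - e := by
      have h3 : n % 3 = 0 ∨ n % 3 = 1 ∨ n % 3 = 2 := by omega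
      rcases h3 with h3 | h3 | h3
      · exact ⟨0, by simp, by omega⟩
      · exact ⟨1, by simp, by omega⟩
      · exact ⟨-1, by simp, by omega⟩
    have hmem : y - e ∈ v.asIdeal := by
      obtain ⟨m, hm⟩ := hne
      have : (n : 𝓞 F) - e = 3 * m := by exact_mod_cast congrArg (Int.cast (R := 𝓞 F)) hm
      rw [← sub_add_sub_cancel y (n : 𝓞 F), this]
      exact add_mem hn (Ideal.mul_mem_right _ _ h)
    rw [← valued_integer_lt_one_iff] at hmem
    have hxe : Valued.v (x - (e : v.adicCompletion F)) < 1 := by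
      have := Valued.v.map_add_lt hy hmem
      simpa using this
    rcases he with rfl | rfl | rfl
    · exact .inl (by simpa using hxe)
    · exact .inr (.inl (by simpa using hxe))
    · exact .inr (.inr (by simpa using hxe))

end Completion

/-! ### The local extension at a prime -/

section LocalExtension

variable {F : Type*} [Field F] [NumberField F] {K : Type*} [Field K] [NumberField K] [Algebra F K]
  (v : HeightOneSpectrum (𝓞 F)) (w : HeightOneSpectrum (𝓞 K)) [w.asIdeal.LiesOver v.asIdeal]

theorem completionMap_algebraMap (x : F) :
    completionMap v w (algebraMap F (v.adicCompletion F) x) =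
      algebraMap K (w.adicCompletion K) (algebraMap F K x) := by
  apply HeightOneSpectrum.adicCompletion.ext
  exact UniformSpace.Completion.map_coe
    (HeightOneSpectrum.uniformContinuous_algebraMap_liesOver F K v w) _

theorem continuous_completionMap : Continuous (completionMap v w) :=
  (HeightOneSpectrum.adicCompletion.continuous_ofCompletion K w).comp
    (UniformSpace.Completion.continuous_map.comp
      (HeightOneSpectrum.adicCompletion.continuous_toCompletion F v))

open scoped Valued in
/-- The completion `K_w` is generated over `F_v` by a generator of `K / F`: the subfield generated
is finite-dimensional over `F_v`, hence closed, and it contains the dense subfield `K`. -/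
theorem adjoin_completion_eq_top [Algebra (v.adicCompletion F) (w.adicCompletion K)]
    (halg : algebraMap (v.adicCompletion F) (w.adicCompletion K) = completionMap v w)
    {α : K} (hint : IsIntegral F α) (hK : IntermediateField.adjoin F {α} = ⊤) :
    IntermediateField.adjoin (v.adicCompletion F) {algebraMap K (w.adicCompletion K) α} = ⊤ := by
  set k := v.adicCompletion F
  set L := w.adicCompletion K
  set E := IntermediateField.adjoin k {algebraMap K L α}
  have hcomm : ∀ x : F, algebraMap K L (algebraMap F K x) = algebraMap k L (algebraMap F k x) :=
    fun x ↦ by rw [halg, completionMap_algebraMap]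
  have hint' : IsIntegral k (algebraMap K L α) := by
    obtain ⟨f, hf, hfα⟩ := hint
    refine ⟨f.map (algebraMap F k), hf.map _, ?_⟩
    have : (algebraMap k L).comp (algebraMap F k) = (algebraMap K L).comp (algebraMap F K) :=
      RingHom.ext fun x ↦ (hcomm x).symm
    rw [Polynomial.eval₂_map, this, ← Polynomial.hom_eval₂, hfα, map_zero]
  have : FiniteDimensional k E := IntermediateField.adjoin.finiteDimensional hint'
  have hcont : ContinuousSMul k L := continuousSMul_of_algebraMap k L (by
    rw [halg]; exact continuous_completionMap v w)
  have hclosed : IsClosed (E : Set L) := by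
    have : FiniteDimensional k (Subalgebra.toSubmodule E.toSubalgebra) := this
    exact (Subalgebra.toSubmodule E.toSubalgebra).closed_of_finiteDimensional
  have hmem : ∀ y : K, algebraMap K L y ∈ E := by
    intro y
    have hy : y ∈ IntermediateField.adjoin F {α} := by rw [hK]; trivial
    induction hy using IntermediateField.adjoin_induction with
    | mem x hx =>
      obtain rfl := hx
      exact IntermediateField.mem_adjoin_simple_self k _
    | algebraMap x => rw [hcomm]; exact E.algebraMap_mem _
    | add x y _ _ hx hy => rw [map_add]; exact add_mem hx hy
    | inv x _ hx => rw [map_inv₀]; exact inv_mem hx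
    | mul x y _ _ hx hy => rw [map_mul]; exact mul_mem hx hy
  rw [eq_top_iff]
  intro z _
  have hdense := (w.denseRange_algebraMap K).closure_range
  have hsub : closure (Set.range (algebraMap K L)) ⊆ E :=
    closure_minimal (by rintro _ ⟨y, rfl⟩; exact hmem y) hclosed
  exact hsub (hdense ▸ Set.mem_univ z)

/-- The conductor condition in terms of the algebra structure given by `completionMap`. -/
theorem mem_conductor_set_iff [alg : Algebra (v.adicCompletion F) (w.adicCompletion K)]
    (halg : alg = (completionMap v w).toAlgebra)
    [FiniteDimensional (v.adicCompletion F) (w.adicCompletion K)] (m : ℕ) :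
    (∀ u ∈ higherUnits v m, ∃ y : (w.adicCompletion K)ˣ,
      localNorm v w (y : w.adicCompletion K) = u) ↔
      HigherUnitsAreNorms (Valued.v : Valuation (v.adicCompletion F) ℤᵐ⁰)
        (w.adicCompletion K) m := by
  have hN : ∀ y, localNorm v w y = Algebra.norm (v.adicCompletion F) y := by
    subst halg
    exact fun _ ↦ rfl
  simp only [hN]
  constructor
  · intro h u hu hum
    obtain ⟨y, hy⟩ := h u ⟨hu, hum⟩
    exact ⟨y, hy⟩
  · rintro h u ⟨hu, hum⟩
    obtain ⟨y, hy⟩ := h u hu hum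
    have hy0 : y ≠ 0 := by
      rintro rfl
      rw [Algebra.norm_zero] at hy
      simp [← hy] at hu
    exact ⟨Units.mk0 y hy0, hy⟩

end LocalExtension

/-! ### The order of `δ` -/

section Values

theorem ord_nonpos_iff {F : Type*} [Field F] [NumberField F] (v : HeightOneSpectrum (𝓞 F)) {x : F}
    (hx : x ≠ 0) : ord v x ≤ 0 ↔ 1 ≤ v.valuation F x := by
  have h : v.valuation F x ≠ 0 := (v.valuation F).ne_zero_iff.mpr hx
  rw [ord, ← WithZero.exp_zero, ← WithZero.exp_log h, WithZero.exp_le_exp, WithZero.log_exp]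
  omega

theorem three_dvd_ord_iff {F : Type*} [Field F] [NumberField F] (v : HeightOneSpectrum (𝓞 F))
    {x : F} (hx : x ≠ 0) : (3 : ℤ) ∣ ord v x ↔
      ∃ y : v.adicCompletion F, v.valuation F x = Valued.v y ^ 3 := by
  have h : v.valuation F x ≠ 0 := (v.valuation F).ne_zero_iff.mpr hx
  rw [ord, dvd_neg]
  constructor
  · rintro ⟨m, hm⟩
    obtain ⟨y, hy⟩ := HeightOneSpectrum.valuedAdicCompletion_surjective F v (WithZero.exp m)
    refine ⟨y, ?_⟩
    rw [hy, ← WithZero.exp_log h, hm, ← WithZero.exp_nsmul]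
    simp
  · rintro ⟨y, hy⟩
    rw [hy, WithZero.log_pow]
    exact ⟨WithZero.log (Valued.v y), by simp⟩

/-- If `δ` vanishes then `g(x; t)` is the cube of `x + t / 3`, so it has no irrational root. -/
theorem delta_ne_zero {F K : Type*} [Field F] [Field K] [Algebra F K] [CharZero F] {t : F} {α : K}
    (hα : α ^ 3 + algebraMap F K t * α ^ 2 - (algebraMap F K t + 3) * α + 1 = 0)
    (hαF : α ∉ Set.range (algebraMap F K)) : delta t ≠ 0 := by
  intro h
  have h3 : (3 : K) ≠ 0 := by
    rw [← map_ofNat (algebraMap F K) 3]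
    exact (map_ne_zero _).mpr three_ne_zero
  have h' : (algebraMap F K t) ^ 2 + 3 * algebraMap F K t + 9 = 0 := by
    simpa [delta, map_ofNat] using congrArg (algebraMap F K) h
  have hcube : (3 * α + algebraMap F K t) ^ 3 = 0 := by
    linear_combination 27 * hα + (9 * α + algebraMap F K t - 3) * h'
  refine hαF ⟨-t / 3, ?_⟩
  rw [map_div₀, map_neg, map_ofNat, div_eq_iff h3]
  linear_combination -(pow_eq_zero_iff three_ne_zero).mp hcube

end Values

end CubicConductor

open CubicConductor in
theorem proposition8p1 {F : Type*} [Field F] [NumberField F]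
    (h3 : CubicConductor.ThreeSplitsCompletely F)
    {K : Type*} [Field K] [NumberField K] [Algebra F K]
    (t : F) (α : K)
    (hroot : Polynomial.aeval α (CubicConductor.genericPoly t) = 0)
    (hα : α ∉ Set.range (algebraMap F K))
    (hK : IntermediateField.adjoin F {α} = ⊤)
    (v : HeightOneSpectrum (𝓞 F)) (w : HeightOneSpectrum (𝓞 K))
    [w.asIdeal.LiesOver v.asIdeal] :
    (CubicConductor.ord v (CubicConductor.delta t) ≤ 0 →
      CubicConductor.IsConductorExponent v w 0) ∧
    (0 < CubicConductor.ord v (CubicConductor.delta t) →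
      (¬ (3 : ℤ) ∣ CubicConductor.ord v (CubicConductor.delta t) →
        ((3 : 𝓞 F) ∉ v.asIdeal → CubicConductor.IsConductorExponent v w 1) ∧
        ((3 : 𝓞 F) ∈ v.asIdeal → CubicConductor.IsConductorExponent v w 2)) ∧
      ((3 : ℤ) ∣ CubicConductor.ord v (CubicConductor.delta t) →
        ((3 : 𝓞 F) ∉ v.asIdeal → CubicConductor.IsConductorExponent v w 0) ∧
        ((3 : 𝓞 F) ∈ v.asIdeal →
          (¬ CubicConductor.IsLocalCube v (CubicConductor.delta t) →
            CubicConductor.IsConductorExponent v w 0) ∧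
          (CubicConductor.IsLocalCube v (CubicConductor.delta t) →
            CubicConductor.IsConductorExponent v w 2)))) := by
  let k := v.adicCompletion F
  let L := w.adicCompletion K
  let alg : Algebra k L := (completionMap v w).toAlgebra
  have hrootK : α ^ 3 + algebraMap F K t * α ^ 2 - (algebraMap F K t + 3) * α + 1 = 0 := by
    simpa [genericPoly, map_ofNat] using hroot
  have hδ0 : delta t ≠ 0 := delta_ne_zero hrootK hα
  have hint : IsIntegral F α := by
    refine IsAlgebraic.isIntegral ⟨genericPoly t, fun h ↦ ?_, hroot⟩
    have := congrArg (Polynomial.eval 0) h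
    simp [genericPoly] at this
  let τ : k := algebraMap F k t
  let β : L := algebraMap K L α
  have htop : IntermediateField.adjoin k {β} = ⊤ := adjoin_completion_eq_top v w rfl hint hK
  have hβ : β ^ 3 + algebraMap k L τ * β ^ 2 - (algebraMap k L τ + 3) * β + 1 = 0 := by
    have hτ : algebraMap k L τ = algebraMap K L (algebraMap F K t) :=
      completionMap_algebraMap v w t
    rw [hτ]
    simpa [map_ofNat] using congrArg (algebraMap K L) hrootK
  have hfin : FiniteDimensional k L := by
    rcases bijective_or_finrank_eq_three hβ htop with h | ⟨h, -⟩
    · exact Module.Finite.of_surjective (Algebra.linearMap k L) h.2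
    · exact Module.finite_of_finrank_pos (by omega)
  let V : Valuation k ℤᵐ⁰ := Valued.v
  have H : CubicHensel V := cubicHensel_completion v
  have hδ : τ ^ 2 + 3 * τ + 9 = algebraMap F k (delta t) := by simp [τ, delta, map_ofNat]
  have hVδ : V (τ ^ 2 + 3 * τ + 9) = v.valuation F (delta t) := by
    rw [hδ]; exact valued_algebraMap v _
  have hδk : τ ^ 2 + 3 * τ + 9 ≠ 0 := by rw [hδ]; exact (map_ne_zero _).mpr hδ0
  have hcube : IsLocalCube v (delta t) ↔ ∃ y : k, y ^ 3 = τ ^ 2 + 3 * τ + 9 := by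
    rw [hδ]
    refine ⟨fun ⟨y, hy⟩ ↦ ⟨y, hy⟩, fun ⟨y, hy⟩ ↦ ⟨Units.mk0 y ?_, hy⟩⟩
    rintro rfl
    exact hδk (by rw [hδ, ← hy]; simp)
  have hset := mem_conductor_set_iff v w (alg := alg) rfl
  have c0 : HigherUnitsAreNorms V L 0 → IsConductorExponent v w 0 := fun h ↦
    ⟨(hset 0).mpr h, fun _ _ ↦ Nat.zero_le _⟩
  have csucc : ∀ n, HigherUnitsAreNorms V L (n + 1) ∧ ¬ HigherUnitsAreNorms V L n →
      IsConductorExponent v w (n + 1) := fun n h ↦ by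
    refine ⟨(hset _).mpr h.1, fun m hm ↦ ?_⟩
    by_contra! hlt
    exact h.2 (((hset m).mp hm).mono (by omega))
  rw [← not_le, ord_nonpos_iff v hδ0, three_dvd_ord_iff v hδ0, ← hVδ, not_le, hcube]
  refine ⟨fun h ↦ ?_, fun hlt ↦ ⟨fun hnd ↦ ⟨fun h3v ↦ ?_, fun h3v ↦ ?_⟩,
    fun ⟨x, hx⟩ ↦ ⟨fun h3v ↦ ?_, fun h3v ↦ ?_⟩⟩⟩
  · by_cases h3v : (3 : 𝓞 F) ∈ v.asIdeal
    · exact c0 ((isThreeAdic_completion v h3 h3v).wild_of_one_le_delta H hβ htop h)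
    · exact c0 (tame_unramified H (valued_three_eq_one v h3v) hβ htop hδk (.inl h))
  · exact csucc 0 (tame_ramified H (valued_three_eq_one v h3v) hβ htop hlt (not_exists.mp hnd))
  · exact csucc 1 ((isThreeAdic_completion v h3 h3v).wild_of_not_cube_value H hβ htop hlt
      (not_exists.mp hnd))
  · exact c0 (tame_unramified H (valued_three_eq_one v h3v) hβ htop hδk (.inr ⟨x, hx⟩))
  · obtain ⟨h1, h2⟩ := (isThreeAdic_completion v h3 h3v).wild_of_cube_value H hβ htop hlt hx
    exact ⟨fun h ↦ c0 (h1 h), fun h ↦ csucc 1 (h2 h)⟩
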